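/- Let $H$ be a separable infinite-dimensional complex Hilbert space, and let $\mathcal T(H)$ be the space of trace-class operators on $H$ with the trace norm $\|X\|_1=\operatorname{Tr}|X|$. A state is a positive trace-class operator of trace one. A channel on $\mathcal T(H)$ is a completely positive and trace-preserving linear map $\Phi:\mathcal T(H)\to\mathcal T(H)$. It is called strongly entanglement breaking (SEB) if for every Hilbert space $R$ and every state $\rho\in\mathcal T(R\otimes H)$ the operator $(I_R\otimes\Phi)(\rho)$ is countably separable, that is, of the form $\sum_{i=1}^\infty p_i\, g_i\otimes h_i$ (convergent in trace norm) with states $g_i\in\mathcal T(R)$, $h_i\in\mathcal T(H)$ and numbers $p_i>0$, $\sum_{i=1}^\infty p_i=1$; here $I_R\otimes\Phi$ is the trace-norm continuous linear map on $\mathcal T(R\otimes H)$ with $A\otimes B\mapsto A\otimes\Phi(B)$. Let $\mathcal N\subseteq\mathcal T(H)$ be a linear subspace that is closed in the trace norm, is self-adjoint ($X\in\mathcal N$ implies $X^*\in\mathcal N$), and consists of operators of trace zero. Then there is an SEB channel $\Phi$ on $\mathcal T(H)$ with $$\{X\in\mathcal T(H):\Phi(X)=0\}=\mathcal N .$$ Moreover,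 $\Phi$ can be chosen of the form $$\Phi(X)=\sum_{k=1}^\infty \operatorname{Tr}(F_kX)\,e_ke_k^*\qquad(X\in\mathcal T(H)),$$ with convergence in trace norm, for some orthonormal basis $(e_k)_{k\ge1}$ of $H$ and positive bounded operators $F_k$ on $H$ with $\sum_{k=1}^\infty F_k=I_H$ (strongly). -/

import Mathlib

open scoped InnerProductSpace TensorProduct ENNReal ComplexOrder

set_option linter.unusedSectionVars false

universe u v w

noncomputable section

namespace SEB

section Operators

variable {H : Type u} [NormedAddCommGroup H] [InnerProductSpace ℂ H] [CompleteSpace H]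

/-- The index set of a chosen orthonormal basis of `H`. -/
def basisIndex (H : Type u) [NormedAddCommGroup H] [InnerProductSpace ℂ H] [CompleteSpace H] :
    Set H :=
  (exists_hilbertBasis ℂ H).choose

/-- A chosen orthonormal basis of the Hilbert space `H`. -/
def basis (H : Type u) [NormedAddCommGroup H] [InnerProductSpace ℂ H] [CompleteSpace H] :
    HilbertBasis (basisIndex H) ℂ H :=
  (exists_hilbertBasis ℂ H).choose_spec.choose

/-- The trace `Tr A = ∑ᵢ ⟨eᵢ, A eᵢ⟩` along the chosen orthonormal basis. The series converges
absolutely when `A` is trace class, see `summable_inner`. -/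
def trace (A : H →L[ℂ] H) : ℂ :=
  ∑' i, ⟪basis H i, A (basis H i)⟫_ℂ

/-- The trace norm `Tr |A| = ∑ᵢ ⟨eᵢ, |A| eᵢ⟩ ∈ [0, ∞]`, where `|A| = (A* A)^(1/2)`. -/
def traceNorm (A : H →L[ℂ] H) : ℝ≥0∞ :=
  ∑' i, ENNReal.ofReal (RCLike.re ⟪basis H i, CFC.abs A (basis H i)⟫_ℂ)

theorem parseval {ι : Type*} (b : HilbertBasis ι ℂ H) (x : H) :
    ∑' i, ‖⟪b i, x⟫_ℂ‖ₑ ^ 2 = ‖x‖ₑ ^ 2 := by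
  have h := (b.hasSum_inner_mul_inner x x).mapL RCLike.reCLM
  have e : ∀ i, RCLike.reCLM (K := ℂ) (⟪x, b i⟫_ℂ * ⟪b i, x⟫_ℂ) = ‖⟪b i, x⟫_ℂ‖ ^ 2 := by
    intro i
    rw [← inner_conj_symm x (b i), RCLike.reCLM_apply, RCLike.conj_mul]
    norm_cast
  simp_rw [e] at h
  rw [RCLike.reCLM_apply, inner_self_eq_norm_sq] at h
  simp_rw [← ofReal_norm, ← ENNReal.ofReal_pow (norm_nonneg _)]
  rw [← ENNReal.ofReal_tsum_of_nonneg (fun i => by positivity) h.summable, h.tsum_eq]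

/-- The sum of `‖S bᵢ‖²` agrees with the sum of `‖S* cⱼ‖²`. -/
theorem hs_adjoint {ι κ : Type*} (b : HilbertBasis ι ℂ H) (c : HilbertBasis κ ℂ H)
    (S : H →L[ℂ] H) :
    ∑' i, ‖S (b i)‖ₑ ^ 2 = ∑' j, ‖(star S) (c j)‖ₑ ^ 2 := by
  simp_rw [← parseval c (S _), ← parseval b ((star S) _)]
  rw [ENNReal.tsum_comm]
  refine tsum_congr fun j => tsum_congr fun i => ?_
  rw [ContinuousLinearMap.star_eq_adjoint, ContinuousLinearMap.adjoint_inner_right,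
    ← inner_conj_symm, ← ofReal_norm (starRingEnd ℂ _), RCLike.norm_conj, ofReal_norm]

theorem hs_comp_le {ι : Type*} (b : ι → H) (W S : H →L[ℂ] H) :
    ∑' i, ‖(W * S) (b i)‖ₑ ^ 2 ≤ ‖W‖ₑ ^ 2 * ∑' i, ‖S (b i)‖ₑ ^ 2 := by
  rw [← ENNReal.tsum_mul_left]
  refine ENNReal.tsum_le_tsum fun i => ?_
  rw [← mul_pow]
  gcongr
  exact ContinuousLinearMap.le_opENorm W (S (b i))

/-- Polar decomposition. -/
theorem exists_polar (A : H →L[ℂ] H) :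
    ∃ U : H →L[ℂ] H, ‖U‖ ≤ 1 ∧ A = U * CFC.abs A ∧ CFC.abs A = star U * A := by
  have hsa : star (CFC.abs A) = CFC.abs A :=
    (IsSelfAdjoint.of_nonneg (CFC.abs_nonneg A)).star_eq
  have habs : ∀ x, ‖A x‖ = ‖CFC.abs A x‖ := by
    intro x
    have h1 : ⟪CFC.abs A x, CFC.abs A x⟫_ℂ = ⟪A x, A x⟫_ℂ := by
      rw [← ContinuousLinearMap.adjoint_inner_right, ← ContinuousLinearMap.adjoint_inner_right,
        ← ContinuousLinearMap.star_eq_adjoint, ← ContinuousLinearMap.star_eq_adjoint, hsa]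
      have := congrArg (fun T : H →L[ℂ] H => T x) (CFC.abs_mul_abs A)
      exact congrArg _ this
    rw [inner_self_eq_norm_sq_to_K, inner_self_eq_norm_sq_to_K] at h1
    have h2 : ‖CFC.abs A x‖ ^ 2 = ‖A x‖ ^ 2 := by exact_mod_cast h1
    exact ((sq_eq_sq₀ (norm_nonneg _) (norm_nonneg _)).1 h2).symm
  set T := CFC.abs A with hT
  let R : Submodule ℂ H := LinearMap.range (T : H →ₗ[ℂ] H)
  let M : Submodule ℂ H := R.topologicalClosure
  have : CompleteSpace M := R.isClosed_topologicalClosure.completeSpace_coe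
  let e : H →ₗ[ℂ] M := (T : H →ₗ[ℂ] H).codRestrict M
    fun x => R.le_topologicalClosure ⟨x, rfl⟩
  have hd : DenseRange e := by
    intro y
    rw [Metric.mem_closure_iff]
    intro ε hε
    have hy : (y : H) ∈ closure (R : Set H) := y.2
    obtain ⟨_, ⟨z, rfl⟩, hz⟩ := Metric.mem_closure_iff.1 hy ε hε
    exact ⟨e z, ⟨z, rfl⟩, hz⟩
  have hn : ∀ x, ‖(A : H →ₗ[ℂ] H) x‖ ≤ 1 * ‖e x‖ := by
    intro x
    rw [one_mul]
    exact (habs x).le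
  let U₀ : M →L[ℂ] H := (A : H →ₗ[ℂ] H).extendOfNorm e
  let U : H →L[ℂ] H := U₀.comp M.orthogonalProjectionOnto
  have hU : ∀ x, U (T x) = A x := by
    intro x
    have h1 : M.orthogonalProjectionOnto (T x) = e x :=
      Submodule.orthogonalProjectionOnto_mem_subspace_eq_self (e x)
    change U₀ (M.orthogonalProjectionOnto (T x)) = A x
    rw [h1]
    exact LinearMap.extendOfNorm_eq hd ⟨1, hn⟩ x
  have hU1 : ‖U‖ ≤ 1 := by
    refine ContinuousLinearMap.opNorm_le_bound _ zero_le_one fun x => ?_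
    refine (LinearMap.norm_extendOfNorm_apply_le hd 1 hn _).trans ?_
    rw [one_mul, one_mul]
    exact Submodule.norm_orthogonalProjectionOnto_apply_le M x
  refine ⟨U, hU1, ?_, ?_⟩
  · ext x
    exact (hU x).symm
  · ext x
    have h1 : ‖(star U) (U (T x)) - T x‖ ^ 2 ≤ 0 := by
      have h3 := norm_sub_sq (𝕜 := ℂ) ((star U) (U (T x))) (T x)
      rw [ContinuousLinearMap.star_eq_adjoint, ContinuousLinearMap.adjoint_inner_left,
        inner_self_eq_norm_sq] at h3
      rw [ContinuousLinearMap.star_eq_adjoint, h3, hU, habs]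
      have h4 : ‖U.adjoint (A x)‖ ≤ ‖T x‖ := by
        rw [← habs x]
        refine (ContinuousLinearMap.le_opNorm _ _).trans ?_
        rw [LinearIsometryEquiv.norm_map]
        exact mul_le_of_le_one_left (norm_nonneg _) hU1
      have h5 : ‖U.adjoint (A x)‖ ^ 2 ≤ ‖T x‖ ^ 2 := by gcongr
      linarith
    have h2 : (star U) (U (T x)) - T x = 0 := by
      rw [← norm_eq_zero]
      exact pow_eq_zero_iff two_ne_zero |>.1 (le_antisymm h1 (by positivity))
    rw [hU] at h2
    exact (sub_eq_zero.1 h2).symm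

theorem traceNorm_eq (A : H →L[ℂ] H) :
    ∃ S : H →L[ℂ] H, star S = S ∧ S * S = CFC.abs A ∧
      ∀ {ι : Type u} (b : HilbertBasis ι ℂ H), traceNorm A = ∑' i, ‖S (b i)‖ₑ ^ 2 := by
  have hsa : star (CFC.sqrt (CFC.abs A)) = CFC.sqrt (CFC.abs A) :=
    (IsSelfAdjoint.of_nonneg (CFC.sqrt_nonneg _)).star_eq
  have hs2 := CFC.sqrt_mul_sqrt_self (CFC.abs A) (CFC.abs_nonneg A)
  refine ⟨CFC.sqrt (CFC.abs A), hsa, hs2, fun {ι} b => ?_⟩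
  rw [hs_adjoint b (basis H), hsa]
  refine tsum_congr fun i => ?_
  have h1 : CFC.abs A (basis H i) =
      (star (CFC.sqrt (CFC.abs A))) (CFC.sqrt (CFC.abs A) (basis H i)) := by
    rw [hsa, ← ContinuousLinearMap.comp_apply]
    exact (congrArg (fun T : H →L[ℂ] H => T (basis H i)) hs2).symm
  rw [h1, ContinuousLinearMap.star_eq_adjoint, ContinuousLinearMap.adjoint_inner_right,
    inner_self_eq_norm_sq, ENNReal.ofReal_pow (norm_nonneg _), ofReal_norm]

theorem tsum_inner_le_hs {ι : Type*} (b : ι → H) (P Q : H →L[ℂ] H) :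
    ∑' i, ‖⟪b i, (P * Q) (b i)⟫_ℂ‖ₑ ≤
      (∑' i, ‖(star P) (b i)‖ₑ ^ 2) ^ (1 / 2 : ℝ) * (∑' i, ‖Q (b i)‖ₑ ^ 2) ^ (1 / 2 : ℝ) := by
  have h := ENNReal.summable (f := fun i => ‖⟪b i, (P * Q) (b i)⟫_ℂ‖ₑ)
  refine h.tsum_le_of_sum_le fun s => ?_
  calc ∑ i ∈ s, ‖⟪b i, (P * Q) (b i)⟫_ℂ‖ₑ
      ≤ ∑ i ∈ s, ‖(star P) (b i)‖ₑ * ‖Q (b i)‖ₑ := by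
        refine Finset.sum_le_sum fun i _ => ?_
        rw [mul_apply_eq_comp, ContinuousLinearMap.star_eq_adjoint,
          ← ContinuousLinearMap.adjoint_inner_left]
        simp only [← ofReal_norm]
        rw [← ENNReal.ofReal_mul (norm_nonneg _)]
        exact ENNReal.ofReal_le_ofReal (norm_inner_le_norm _ _)
    _ ≤ (∑ i ∈ s, ‖(star P) (b i)‖ₑ ^ (2 : ℝ)) ^ (1 / 2 : ℝ) *
          (∑ i ∈ s, ‖Q (b i)‖ₑ ^ (2 : ℝ)) ^ (1 / 2 : ℝ) :=
        ENNReal.inner_le_Lp_mul_Lq s _ _ Real.HolderConjugate.two_two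
    _ ≤ _ := by
        simp only [ENNReal.rpow_ofNat]
        gcongr <;> exact ENNReal.sum_le_tsum s

/-- If `A` has trace norm `t`, then `∑ |⟨bᵢ, V A W bᵢ⟩| ≤ ‖V‖ ‖W‖ t` for every orthonormal
basis. -/
theorem tsum_inner_le {ι : Type u} (b : HilbertBasis ι ℂ H) (V A W : H →L[ℂ] H) :
    ∑' i, ‖⟪b i, (V * A * W) (b i)⟫_ℂ‖ₑ ≤ ‖V‖ₑ * ‖W‖ₑ * traceNorm A := by
  obtain ⟨U, hU, hA, -⟩ := exists_polar A
  obtain ⟨S, hS, hSS, hn⟩ := traceNorm_eq A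
  have h1 : V * A * W = (V * U * S) * (S * W) := by
    rw [hA, ← hSS]; simp only [mul_assoc]
  rw [h1]
  refine (tsum_inner_le_hs b _ _).trans ?_
  have hU' : ‖U‖ₑ ≤ 1 := by
    rw [← ofReal_norm]; exact ENNReal.ofReal_le_one.2 hU
  have h2 : ∑' i, ‖(star (V * U * S)) (b i)‖ₑ ^ 2 ≤ ‖V‖ₑ ^ 2 * traceNorm A := by
    rw [← hs_adjoint b b, hn b]
    refine (hs_comp_le _ _ _).trans ?_
    gcongr
    calc ‖V * U‖ₑ ≤ ‖V‖ₑ * ‖U‖ₑ := by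
          simp only [← ofReal_norm]
          rw [← ENNReal.ofReal_mul (norm_nonneg _)]
          exact ENNReal.ofReal_le_ofReal (norm_mul_le _ _)
      _ ≤ ‖V‖ₑ * 1 := by gcongr
      _ = ‖V‖ₑ := mul_one _
  have h3 : ∑' i, ‖(S * W) (b i)‖ₑ ^ 2 ≤ ‖W‖ₑ ^ 2 * traceNorm A := by
    rw [hs_adjoint b b, hn b, star_mul, hS]
    refine (hs_comp_le _ _ _).trans ?_
    rw [← ofReal_norm (star W), norm_star, ofReal_norm]
  calc _ ≤ (‖V‖ₑ ^ 2 * traceNorm A) ^ (1 / 2 : ℝ) * (‖W‖ₑ ^ 2 * traceNorm A) ^ (1 / 2 : ℝ) := by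
        gcongr
    _ = ‖V‖ₑ * ‖W‖ₑ * traceNorm A := by
        have key : ∀ x : ℝ≥0∞, (x ^ 2) ^ (1 / 2 : ℝ) = x := by
          intro x
          rw [← ENNReal.rpow_ofNat, ← ENNReal.rpow_mul]
          norm_num
        rw [ENNReal.mul_rpow_of_nonneg _ _ (by norm_num),
          ENNReal.mul_rpow_of_nonneg _ _ (by norm_num), key, key, mul_mul_mul_comm,
          ← ENNReal.mul_rpow_of_nonneg _ _ (by norm_num), ← sq, key]

theorem traceNorm_le_of_polar (A : H →L[ℂ] H) :
    ∃ U : H →L[ℂ] H, ‖U‖ₑ ≤ 1 ∧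
      traceNorm A = ∑' i, ‖⟪basis H i, (star U * A) (basis H i)⟫_ℂ‖ₑ := by
  obtain ⟨U, hU, -, hA⟩ := exists_polar A
  refine ⟨U, ?_, tsum_congr fun i => ?_⟩
  · rw [← ofReal_norm]; exact ENNReal.ofReal_le_one.2 hU
  · rw [← hA, ← ofReal_norm]
    have hp : (CFC.abs A).IsPositive :=
      (ContinuousLinearMap.nonneg_iff_isPositive _).1 (CFC.abs_nonneg A)
    have h2 := congrArg RCLike.re (RCLike.norm_of_nonneg' (hp.inner_nonneg_right (basis H i)))
    rw [RCLike.ofReal_re] at h2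
    rw [h2]

theorem tsum_inner_lt_top (A : H →L[ℂ] H) (hA : traceNorm A ≠ ∞) :
    ∑' i, ‖⟪basis H i, A (basis H i)⟫_ℂ‖ₑ ≠ ∞ := by
  have h := tsum_inner_le (basis H) 1 A 1
  rw [one_mul, mul_one] at h
  exact ne_top_of_le_ne_top (ENNReal.mul_ne_top (ENNReal.mul_ne_top enorm_ne_top enorm_ne_top) hA) h

/-- The series that defines the trace of a trace-class operator converges absolutely. -/
theorem summable_inner (A : H →L[ℂ] H) (hA : traceNorm A ≠ ∞) :
    Summable fun i => ‖⟪basis H i, A (basis H i)⟫_ℂ‖ := by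
  have h := ENNReal.summable_toReal (tsum_inner_lt_top A hA)
  simpa using h

theorem traceNorm_mul_mul_le (V A W : H →L[ℂ] H) :
    traceNorm (V * A * W) ≤ ‖V‖ₑ * ‖W‖ₑ * traceNorm A := by
  obtain ⟨U, hU, h⟩ := traceNorm_le_of_polar (V * A * W)
  rw [h, ← mul_assoc, ← mul_assoc]
  refine (tsum_inner_le (basis H) (star U * V) A W).trans ?_
  gcongr
  calc ‖star U * V‖ₑ ≤ ‖U‖ₑ * ‖V‖ₑ := by
        simp only [← ofReal_norm]
        rw [← ENNReal.ofReal_mul (norm_nonneg _), ← norm_star U]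
        exact ENNReal.ofReal_le_ofReal (norm_mul_le _ _)
    _ ≤ 1 * ‖V‖ₑ := by gcongr
    _ = ‖V‖ₑ := one_mul _

theorem enorm_one_le : ‖(1 : H →L[ℂ] H)‖ₑ ≤ 1 := by
  rw [← ofReal_norm]
  exact ENNReal.ofReal_le_one.2 ContinuousLinearMap.norm_id_le

theorem traceNorm_mul_le (V A : H →L[ℂ] H) : traceNorm (V * A) ≤ ‖V‖ₑ * traceNorm A := by
  have h := traceNorm_mul_mul_le V A 1
  rw [mul_one] at h
  refine h.trans ?_
  calc ‖V‖ₑ * ‖(1 : H →L[ℂ] H)‖ₑ * traceNorm A ≤ ‖V‖ₑ * 1 * traceNorm A := by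
        gcongr; exact enorm_one_le
    _ = ‖V‖ₑ * traceNorm A := by rw [mul_one]

theorem tsum_inner_mul_le (V A : H →L[ℂ] H) (hV : ‖V‖ₑ ≤ 1) :
    ∑' i, ‖⟪basis H i, (V * A) (basis H i)⟫_ℂ‖ₑ ≤ traceNorm A := by
  have h := tsum_inner_le (basis H) V A 1
  rw [mul_one] at h
  refine h.trans ?_
  calc ‖V‖ₑ * ‖(1 : H →L[ℂ] H)‖ₑ * traceNorm A ≤ 1 * 1 * traceNorm A := by
        gcongr; exact enorm_one_le
    _ = traceNorm A := by rw [mul_one, one_mul]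

theorem enorm_star (U : H →L[ℂ] H) : ‖star U‖ₑ = ‖U‖ₑ := by
  rw [← ofReal_norm, norm_star, ofReal_norm]

theorem traceNorm_add_le (A B : H →L[ℂ] H) : traceNorm (A + B) ≤ traceNorm A + traceNorm B := by
  obtain ⟨U, hU, h⟩ := traceNorm_le_of_polar (A + B)
  have hU' : ‖star U‖ₑ ≤ 1 := by rwa [enorm_star]
  rw [h, mul_add]
  calc ∑' i, ‖⟪basis H i, (star U * A + star U * B) (basis H i)⟫_ℂ‖ₑ
      ≤ ∑' i, (‖⟪basis H i, (star U * A) (basis H i)⟫_ℂ‖ₑ +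
          ‖⟪basis H i, (star U * B) (basis H i)⟫_ℂ‖ₑ) := by
        refine ENNReal.tsum_le_tsum fun i => ?_
        rw [add_apply, inner_add_right]
        exact enorm_add_le _ _
    _ ≤ _ := by
        rw [ENNReal.tsum_add]
        exact add_le_add (tsum_inner_mul_le _ A hU') (tsum_inner_mul_le _ B hU')

theorem traceNorm_smul_le (c : ℂ) (A : H →L[ℂ] H) : traceNorm (c • A) ≤ ‖c‖ₑ * traceNorm A := by
  have h := traceNorm_mul_le (c • (1 : H →L[ℂ] H)) A
  rw [smul_mul_assoc, one_mul] at h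
  refine h.trans ?_
  rw [enorm_smul]
  calc ‖c‖ₑ * ‖(1 : H →L[ℂ] H)‖ₑ * traceNorm A ≤ ‖c‖ₑ * 1 * traceNorm A := by
        gcongr; exact enorm_one_le
    _ = ‖c‖ₑ * traceNorm A := by rw [mul_one]

theorem traceNorm_zero : traceNorm (0 : H →L[ℂ] H) = 0 := by
  simp [traceNorm]

theorem traceNorm_neg (A : H →L[ℂ] H) : traceNorm (-A) = traceNorm A := by
  simp [traceNorm]

theorem traceNorm_star_le (A : H →L[ℂ] H) : traceNorm (star A) ≤ traceNorm A := by
  obtain ⟨U, hU, h1, h2⟩ := exists_polar A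
  have hsa : star (CFC.abs A) = CFC.abs A :=
    (IsSelfAdjoint.of_nonneg (CFC.abs_nonneg A)).star_eq
  have h3 : star A = star U * A * star U := by
    rw [← h2]
    conv_lhs => rw [h1]
    rw [star_mul, hsa]
  have hU' : ‖star U‖ₑ ≤ 1 := by
    rw [enorm_star, ← ofReal_norm]; exact ENNReal.ofReal_le_one.2 hU
  rw [h3]
  refine (traceNorm_mul_mul_le _ _ _).trans ?_
  calc _ ≤ 1 * 1 * traceNorm A := by gcongr
    _ = traceNorm A := by rw [one_mul, one_mul]

theorem eq_zero_of_traceNorm (A : H →L[ℂ] H) (hA : traceNorm A = 0) : A = 0 := by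
  obtain ⟨U, -, h1, -⟩ := exists_polar A
  obtain ⟨S, hS, hSS, hn⟩ := traceNorm_eq A
  have h2 : S = 0 := by
    rw [hn (basis H), hs_adjoint (basis H) (basis H), hS, ENNReal.tsum_eq_zero] at hA
    rw [← hS]
    ext x
    refine ext_inner_left ℂ fun y => ?_
    have h3 : ∀ i, S (basis H i) = 0 := by
      intro i
      have := hA i
      rw [pow_eq_zero_iff two_ne_zero, enorm_eq_zero] at this
      exact this
    rw [hS]
    have h4 : S x = 0 := by
      have h5 := ((basis H).hasSum_repr x).mapL S
      simp only [map_smul, h3, smul_zero] at h5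
      exact h5.unique hasSum_zero
    rw [h4]; rfl
  rw [h1, ← hSS, h2, mul_zero, mul_zero]

variable (H) in
/-- The trace-class operators, as a subspace of `B(H)`: those with `Tr |A| < ∞`. -/
def traceClassSubmodule : Submodule ℂ (H →L[ℂ] H) where
  carrier := {A | traceNorm A ≠ ∞}
  add_mem' {A B} hA hB :=
    ne_top_of_le_ne_top (ENNReal.add_ne_top.2 ⟨hA, hB⟩) (traceNorm_add_le A B)
  zero_mem' := by
    change traceNorm (0 : H →L[ℂ] H) ≠ ∞
    rw [traceNorm_zero]; exact ENNReal.zero_ne_top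
  smul_mem' c A hA :=
    ne_top_of_le_ne_top (ENNReal.mul_ne_top enorm_ne_top hA) (traceNorm_smul_le c A)

end Operators

/-- The space `T(H)` of trace-class operators on the Hilbert space `H`. It is a type of its own
because it carries the trace norm and not the operator norm. -/
def TraceClass (H : Type u) [NormedAddCommGroup H] [InnerProductSpace ℂ H] [CompleteSpace H] :
    Type u :=
  traceClassSubmodule H

namespace TraceClass

variable {H : Type u} [NormedAddCommGroup H] [InnerProductSpace ℂ H] [CompleteSpace H]
variable {K : Type v} [NormedAddCommGroup K] [InnerProductSpace ℂ K] [CompleteSpace K]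

instance : AddCommGroup (TraceClass H) := inferInstanceAs (AddCommGroup (traceClassSubmodule H))

instance : Module ℂ (TraceClass H) := inferInstanceAs (Module ℂ (traceClassSubmodule H))

/-- The bounded operator underlying a trace-class operator. -/
def op (X : TraceClass H) : H →L[ℂ] H := X.1

theorem traceNorm_op_ne_top (X : TraceClass H) : traceNorm X.op ≠ ∞ := X.2

theorem op_injective : Function.Injective (op : TraceClass H → H →L[ℂ] H) :=
  Subtype.val_injective

@[simp] theorem op_add (X Y : TraceClass H) : (X + Y).op = X.op + Y.op := rfl

@[simp] theorem op_zero : (0 : TraceClass H).op = 0 := rfl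

@[simp] theorem op_neg (X : TraceClass H) : (-X).op = -X.op := rfl

@[simp] theorem op_smul (c : ℂ) (X : TraceClass H) : (c • X).op = c • X.op := rfl

/-- `T(H)` is normed by the trace norm `‖X‖₁ = Tr |X|`. -/
instance : NormedAddCommGroup (TraceClass H) :=
  AddGroupNorm.toNormedAddCommGroup
    { toFun := fun X => (traceNorm X.op).toReal
      map_zero' := by simp [traceNorm_zero]
      add_le' := fun X Y => by
        rw [← ENNReal.toReal_add X.traceNorm_op_ne_top Y.traceNorm_op_ne_top]
        exact ENNReal.toReal_mono
          (ENNReal.add_ne_top.2 ⟨X.traceNorm_op_ne_top, Y.traceNorm_op_ne_top⟩)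
          (traceNorm_add_le X.op Y.op)
      neg' := fun X => by rw [op_neg, traceNorm_neg]
      eq_zero_of_map_eq_zero' := fun X hX => by
        rcases (ENNReal.toReal_eq_zero_iff _).1 hX with h | h
        · exact op_injective (eq_zero_of_traceNorm _ h)
        · exact absurd h X.traceNorm_op_ne_top }

theorem norm_def (X : TraceClass H) : ‖X‖ = (traceNorm X.op).toReal := rfl

instance : NormedSpace ℂ (TraceClass H) where
  norm_smul_le c X := by
    rw [norm_def, norm_def, op_smul, ← toReal_enorm c, ← ENNReal.toReal_mul]
    exact ENNReal.toReal_mono (ENNReal.mul_ne_top enorm_ne_top X.traceNorm_op_ne_top)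
      (traceNorm_smul_le c X.op)

/-- The involution of `T(H)` is the adjoint of operators. -/
instance : Star (TraceClass H) where
  star X := ⟨star X.op, ne_top_of_le_ne_top X.traceNorm_op_ne_top (traceNorm_star_le X.op)⟩

/-- The product `F X` of a bounded operator `F` and a trace-class operator `X`. -/
def lmul (F : H →L[ℂ] H) (X : TraceClass H) : TraceClass H :=
  ⟨F * X.op, ne_top_of_le_ne_top (ENNReal.mul_ne_top enorm_ne_top X.traceNorm_op_ne_top)
    (traceNorm_mul_le F X.op)⟩

/-- A state: a positive trace-class operator of trace one. -/
def IsState (X : TraceClass H) : Prop :=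
  X.op.IsPositive ∧ trace X.op = 1

theorem op_star (X : TraceClass H) : (star X).op = star X.op := rfl

theorem op_lmul (F : H →L[ℂ] H) (X : TraceClass H) : (lmul F X).op = F * X.op := rfl

end TraceClass

section Tensor

/-- The Hilbert space tensor product: the completion of the algebraic tensor product for the
inner product `⟨x ⊗ y, x' ⊗ y'⟩ = ⟨x, x'⟩ ⟨y, y'⟩`. -/
abbrev HilbertTensor (R : Type u) (H : Type v) [NormedAddCommGroup R] [InnerProductSpace ℂ R]
    [NormedAddCommGroup H] [InnerProductSpace ℂ H] : Type (max u v) :=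
  UniformSpace.Completion (R ⊗[ℂ] H)

variable {R : Type u} [NormedAddCommGroup R] [InnerProductSpace ℂ R]
variable {H : Type v} [NormedAddCommGroup H] [InnerProductSpace ℂ H]

/-- The bounded operator `A ⊗ B` on the Hilbert space tensor product, determined by
`(A ⊗ B) (x ⊗ y) = A x ⊗ B y`. -/
def tensorOp (A : R →L[ℂ] R) (B : H →L[ℂ] H) : HilbertTensor R H →L[ℂ] HilbertTensor R H :=
  (TensorProduct.mapL A B).completion

theorem tensorOp_coe_tmul (A : R →L[ℂ] R) (B : H →L[ℂ] H) (x : R) (y : H) :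
    tensorOp A B ((x ⊗ₜ[ℂ] y : R ⊗[ℂ] H) : HilbertTensor R H) =
      ((A x ⊗ₜ[ℂ] B y : R ⊗[ℂ] H) : HilbertTensor R H) := by
  rw [tensorOp, ContinuousLinearMap.completion_apply_coe, TensorProduct.mapL_tmul]

/-- Two bounded operators on the tensor product agree if they do on elementary tensors. -/
theorem tensor_ext {S T : HilbertTensor R H →L[ℂ] HilbertTensor R H}
    (h : ∀ x y, S ((x ⊗ₜ[ℂ] y : R ⊗[ℂ] H) : HilbertTensor R H) =
      T ((x ⊗ₜ[ℂ] y : R ⊗[ℂ] H) : HilbertTensor R H)) : S = T := by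
  ext z
  induction z using UniformSpace.Completion.induction_on with
  | hp => exact isClosed_eq S.continuous T.continuous
  | ih z =>
    induction z using TensorProduct.induction_on with
    | zero => rw [UniformSpace.Completion.coe_zero, map_zero, map_zero]
    | tmul x y => exact h x y
    | add a b ha hb => rw [UniformSpace.Completion.coe_add, map_add, map_add, ha, hb]

theorem tensorOp_mul (A A' : R →L[ℂ] R) (B B' : H →L[ℂ] H) :
    tensorOp (A * A') (B * B') = tensorOp A B * tensorOp A' B' := by
  refine tensor_ext fun x y => ?_
  change _ = tensorOp A B (tensorOp A' B' _)
  rw [tensorOp_coe_tmul, tensorOp_coe_tmul, tensorOp_coe_tmul]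
  rfl

variable [CompleteSpace R] [CompleteSpace H]

/-- The orthonormal basis `bᵢ ⊗ cⱼ` of the tensor product. -/
theorem exists_tensorBasis {ι κ : Type*} (b : HilbertBasis ι ℂ R) (c : HilbertBasis κ ℂ H) :
    ∃ d : HilbertBasis (ι × κ) ℂ (HilbertTensor R H), ∀ i,
      d i = ((b i.1 ⊗ₜ[ℂ] c i.2 : R ⊗[ℂ] H) : HilbertTensor R H) := by
  have ho : Orthonormal ℂ fun i : ι × κ =>
      ((b i.1 ⊗ₜ[ℂ] c i.2 : R ⊗[ℂ] H) : HilbertTensor R H) :=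
    (b.orthonormal.tmul c.orthonormal).comp_linearIsometry UniformSpace.Completion.toComplₗᵢ
  refine ⟨HilbertBasis.mk ho ?_, fun i => by rw [HilbertBasis.coe_mk]⟩
  set M := (Submodule.span ℂ (Set.range fun i : ι × κ =>
      ((b i.1 ⊗ₜ[ℂ] c i.2 : R ⊗[ℂ] H) : HilbertTensor R H))).topologicalClosure with hM
  have hMc : IsClosed (M : Set (HilbertTensor R H)) := Submodule.isClosed_topologicalClosure _
  let τ : R →L[ℂ] H →L[ℂ] HilbertTensor R H :=
    (ContinuousLinearMap.compL ℂ H (R ⊗[ℂ] H) (HilbertTensor R H)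
      UniformSpace.Completion.toComplL).comp (TensorProduct.mkL ℂ R H)
  have hτ : ∀ x y, τ x y = ((x ⊗ₜ[ℂ] y : R ⊗[ℂ] H) : HilbertTensor R H) := fun _ _ => rfl
  have h1 : ∀ i y, τ (b i) y ∈ M := by
    intro i y
    refine hMc.mem_of_tendsto ((c.hasSum_repr y).mapL (τ (b i))) (Filter.Eventually.of_forall ?_)
    intro s
    refine Submodule.sum_mem _ fun j _ => ?_
    rw [map_smul]
    exact M.smul_mem _ (Submodule.le_topologicalClosure _ (Submodule.subset_span ⟨(i, j), rfl⟩))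
  have h2 : ∀ x y, τ x y ∈ M := by
    intro x y
    refine hMc.mem_of_tendsto ((b.hasSum_repr x).mapL (τ.flip y)) (Filter.Eventually.of_forall ?_)
    intro s
    refine Submodule.sum_mem _ fun j _ => ?_
    rw [map_smul]
    exact M.smul_mem _ (h1 j y)
  suffices key : ∀ z, z ∈ M from fun z _ => key z
  intro z
  induction z using UniformSpace.Completion.induction_on with
  | hp => exact hMc
  | ih z =>
    induction z using TensorProduct.induction_on with
    | zero => rw [UniformSpace.Completion.coe_zero]; exact M.zero_mem
    | tmul x y => exact h2 x y
    | add a b ha hb =>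
      rw [UniformSpace.Completion.coe_add]
      exact M.add_mem ha hb

theorem hs_tensorOp (b : HilbertBasis (basisIndex R) ℂ R) (c : HilbertBasis (basisIndex H) ℂ H)
    {ι : Type*} (d : HilbertBasis ι ℂ (HilbertTensor R H)) (S : R →L[ℂ] R) (T : H →L[ℂ] H) :
    ∑' i, ‖tensorOp S T (d i)‖ₑ ^ 2 = (∑' i, ‖S (b i)‖ₑ ^ 2) * ∑' j, ‖T (c j)‖ₑ ^ 2 := by
  obtain ⟨f, hf⟩ := exists_tensorBasis b c
  rw [hs_adjoint d f, ← hs_adjoint f f, ENNReal.tsum_prod', ← ENNReal.tsum_mul_right]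
  refine tsum_congr fun i => ?_
  rw [← ENNReal.tsum_mul_left]
  refine tsum_congr fun j => ?_
  rw [hf, tensorOp_coe_tmul, ← mul_pow]
  congr 1
  simp only [← ofReal_norm]
  rw [UniformSpace.Completion.norm_coe, TensorProduct.norm_tmul,
    ENNReal.ofReal_mul (norm_nonneg _)]

theorem traceNorm_tensorOp_ne_top (A : R →L[ℂ] R) (B : H →L[ℂ] H) (hA : traceNorm A ≠ ∞)
    (hB : traceNorm B ≠ ∞) : traceNorm (tensorOp A B) ≠ ∞ := by
  obtain ⟨U, -, hU, -⟩ := exists_polar A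
  obtain ⟨V, -, hV, -⟩ := exists_polar B
  obtain ⟨S, -, hS, hSn⟩ := traceNorm_eq A
  obtain ⟨T, -, hT, hTn⟩ := traceNorm_eq B
  obtain ⟨W, hW, h⟩ := traceNorm_le_of_polar (tensorOp A B)
  have h1 : star W * tensorOp A B = (star W * tensorOp U V * tensorOp S T) * tensorOp S T := by
    rw [hU, hV, ← hS, ← hT, tensorOp_mul, tensorOp_mul]
    simp only [mul_assoc]
  have h2 : ∑' i, ‖tensorOp S T (basis (HilbertTensor R H) i)‖ₑ ^ 2 ≠ ∞ := by
    rw [hs_tensorOp (basis R) (basis H), ← hSn, ← hTn]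
    exact ENNReal.mul_ne_top hA hB
  rw [h, h1]
  refine ne_top_of_le_ne_top (ENNReal.mul_ne_top ?_ ?_) (tsum_inner_le_hs _ _ _)
  · rw [← hs_adjoint (basis _) (basis _)]
    refine ENNReal.rpow_ne_top_of_nonneg (by norm_num) ?_
    exact ne_top_of_le_ne_top (ENNReal.mul_ne_top (ENNReal.pow_ne_top enorm_ne_top) h2)
      (hs_comp_le _ _ _)
  · exact ENNReal.rpow_ne_top_of_nonneg (by norm_num) h2

/-- The tensor product `A ⊗ B ∈ T(R ⊗ H)` of `A ∈ T(R)` and `B ∈ T(H)`. -/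
def TraceClass.tmul (A : TraceClass R) (B : TraceClass H) : TraceClass (HilbertTensor R H) :=
  ⟨tensorOp A.op B.op,
    traceNorm_tensorOp_ne_top _ _ A.traceNorm_op_ne_top B.traceNorm_op_ne_top⟩

theorem TraceClass.op_tmul (A : TraceClass R) (B : TraceClass H) :
    (A.tmul B).op = tensorOp A.op B.op := rfl

/-- A state `σ` on `R ⊗ H` is countably separable if `σ = ∑ pᵢ gᵢ ⊗ hᵢ`, an infinite convex
combination of product states, with convergence in trace norm. -/
def IsCountablySeparable (σ : TraceClass (HilbertTensor R H)) : Prop :=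
  ∃ (p : ℕ → ℝ) (g : ℕ → TraceClass R) (h : ℕ → TraceClass H),
    (∀ i, 0 < p i) ∧ HasSum p 1 ∧ (∀ i, (g i).IsState) ∧ (∀ i, (h i).IsState) ∧
      HasSum (fun i => (p i : ℂ) • (g i).tmul (h i)) σ

end Tensor

section Channels

variable {H : Type u} [NormedAddCommGroup H] [InnerProductSpace ℂ H] [CompleteSpace H]
variable {K : Type v} [NormedAddCommGroup K] [InnerProductSpace ℂ K] [CompleteSpace K]

/-- An `n × n` matrix of trace-class operators on `H` is positive if it is so as an operator on
the direct sum of `n` copies of `H`. -/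
def IsPositiveMatrix {n : ℕ} (X : Fin n → Fin n → TraceClass H) : Prop :=
  ∀ x : Fin n → H, 0 ≤ ∑ i, ∑ j, ⟪x i, (X i j).op (x j)⟫_ℂ

/-- Complete positivity: for each `n`, the map that `Φ` induces on `n × n` matrices of trace-class
operators preserves positivity. -/
def IsCompletelyPositive (Φ : TraceClass H →ₗ[ℂ] TraceClass K) : Prop :=
  ∀ (n : ℕ) (X : Fin n → Fin n → TraceClass H), IsPositiveMatrix X →
    IsPositiveMatrix fun i j => Φ (X i j)

/-- A quantum channel: a completely positive and trace-preserving linear map. -/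
def IsChannel (Φ : TraceClass H →ₗ[ℂ] TraceClass K) : Prop :=
  IsCompletelyPositive Φ ∧ ∀ X, trace (Φ X).op = trace X.op

/-- `Ψ` is the ampliation `I_R ⊗ Φ`: the trace-norm continuous linear map with
`Ψ (A ⊗ B) = A ⊗ Φ B` for `A ∈ T(R)` and `B ∈ T(H)`. There is at most one, since the operators
`A ⊗ B` span a dense subspace of `T(R ⊗ H)`. -/
def IsAmpliation {R : Type w} [NormedAddCommGroup R] [InnerProductSpace ℂ R] [CompleteSpace R]
    (Φ : TraceClass H →ₗ[ℂ] TraceClass K)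
    (Ψ : TraceClass (HilbertTensor R H) →L[ℂ] TraceClass (HilbertTensor R K)) : Prop :=
  ∀ (A : TraceClass R) (B : TraceClass H), Ψ (A.tmul B) = A.tmul (Φ B)

/-- A map `Φ` is strongly entanglement breaking if for every Hilbert space `R` the map `I_R ⊗ Φ`
exists and sends every state on `R ⊗ H` to a countably separable state. -/
def IsSEB (Φ : TraceClass H →ₗ[ℂ] TraceClass K) : Prop :=
  ∀ (R : Type w) [NormedAddCommGroup R] [InnerProductSpace ℂ R] [CompleteSpace R],
    ∃ Ψ : TraceClass (HilbertTensor R H) →L[ℂ] TraceClass (HilbertTensor R K),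
      IsAmpliation Φ Ψ ∧ ∀ ρ, ρ.IsState → IsCountablySeparable (Ψ ρ)

/-- The Holevo form `Φ X = ∑ₖ Rₖ Tr (Fₖ X)` of `Φ`, for states `Rₖ` and positive bounded operators
`Fₖ` with `∑ₖ Fₖ = I`. The first series converges in trace norm and the second one strongly. -/
def HasHolevoForm (Φ : TraceClass H →ₗ[ℂ] TraceClass K) (R : ℕ → TraceClass K)
    (F : ℕ → H →L[ℂ] H) : Prop :=
  (∀ k, (R k).IsState) ∧ (∀ k, (F k).IsPositive) ∧ (∀ x, HasSum (fun k => F k x) x) ∧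
    ∀ X, HasSum (fun k => trace (TraceClass.lmul (F k) X).op • R k) (Φ X)

end Channels

end SEB

end

/-! If the vectors `e k` are orthonormal, the measure-and-prepare map `X ↦ ∑ Tr (Fₖ X) |eₖ⟩⟨eₖ|`
loses nothing beyond the numbers `Tr (Fₖ X)`: they are its diagonal matrix elements
(`holevoMap_eq_zero_iff`). It is therefore enough to write `N` as the common kernel of positive
operators that sum to the identity (`exists_effects`).

Continuous functionals on `T(H)` are `X ↦ Tr (B X)` with `B` bounded, so by Hahn–Banach the
annihilator of the closed space `N` separates `N` from every point outside it. As `N` is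
self-adjoint, the annihilator is closed under adjoints and self-adjoint contractions suffice; as
`T(H)` is separable, countably many `B j` suffice (`exists_seq_trace_eq_zero_iff`). The identity
also annihilates `N`, because `N` has trace zero. So the positive operators `1 + B j` annihilate `N`
too, and with small weights their sum `S` satisfies `S ≤ 1`. The remainder `1 - S` completes the
resolution of the identity and, conversely, makes the trace recoverable from the numbers `Tr (Fₖ
X)`.

The weights are geometric, so `∑ ‖Fₖ‖ < ∞` and the series for the map and for its ampliation
converge absolutely in operator norm. The ampliation is `ρ ↦ ∑ Tr_H ((I ⊗ Fₖ) ρ) ⊗ Rₖ`. For a state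
`ρ` its terms are positive product operators with total trace one, and normalizing them shows that
the image is countably separable (`isCountablySeparable_of_hasSum`).

The supporting theory of `T(H)` rests on `hasSum_ketBra`: rank-one operators span a dense subspace,
so identities between continuous linear maps need checking only there. -/

open scoped Topology

namespace SEB

open InnerProductSpace (rankOne rankOne_apply)

/-! ### Hilbert–Schmidt estimates and semicontinuity of the trace norm -/

section Operators

variable {H : Type u} [NormedAddCommGroup H] [InnerProductSpace ℂ H] [CompleteSpace H]

/-- The sum of `‖S bᵢ‖²` does not depend on the orthonormal basis. -/
theorem hs_basis_eq {ι κ : Type*} (b : HilbertBasis ι ℂ H) (c : HilbertBasis κ ℂ H)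
    (S : H →L[ℂ] H) : ∑' i, ‖S (b i)‖ₑ ^ 2 = ∑' j, ‖S (c j)‖ₑ ^ 2 := by
  rw [hs_adjoint b c, ← hs_adjoint c c]

/-- The trace norm of a product is bounded by the Hilbert–Schmidt norms of the factors. -/
theorem traceNorm_mul_le_hs {ι : Type*} (b : HilbertBasis ι ℂ H) (P Q : H →L[ℂ] H) :
    traceNorm (P * Q) ≤
      (∑' i, ‖P (b i)‖ₑ ^ 2) ^ (1 / 2 : ℝ) * (∑' i, ‖Q (b i)‖ₑ ^ 2) ^ (1 / 2 : ℝ) := by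
  obtain ⟨W, hW, h⟩ := traceNorm_le_of_polar (P * Q)
  rw [h, ← mul_assoc]
  refine (tsum_inner_le_hs _ _ _).trans ?_
  rw [hs_basis_eq (basis H) b Q, ← hs_adjoint b (basis H)]
  refine mul_le_mul' (ENNReal.rpow_le_rpow ?_ (by norm_num)) le_rfl
  refine (hs_comp_le b (star W) P).trans ?_
  rw [enorm_star]
  calc ‖W‖ₑ ^ 2 * ∑' i, ‖P (b i)‖ₑ ^ 2 ≤ 1 * ∑' i, ‖P (b i)‖ₑ ^ 2 := by
        gcongr; exact pow_le_one₀ zero_le hW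
    _ = _ := one_mul _

/-- Parseval expands `S x`, and Cauchy–Schwarz bounds each coefficient `⟪S* bᵢ, x⟫`. This makes the
Hilbert–Schmidt norm dominate the operator norm. -/
theorem enorm_sq_le_hs (S : H →L[ℂ] H) {ι : Type*} (b : HilbertBasis ι ℂ H) (x : H) :
    ‖S x‖ₑ ^ 2 ≤ (∑' i, ‖S (b i)‖ₑ ^ 2) * ‖x‖ₑ ^ 2 := by
  rw [hs_adjoint b b, ← parseval b (S x), ← ENNReal.tsum_mul_right]
  refine ENNReal.tsum_le_tsum fun i => ?_
  rw [← mul_pow, ContinuousLinearMap.star_eq_adjoint, ← ContinuousLinearMap.adjoint_inner_left]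
  gcongr
  simp only [← ofReal_norm]
  rw [← ENNReal.ofReal_mul (norm_nonneg _)]
  exact ENNReal.ofReal_le_ofReal (norm_inner_le_norm _ _)

/-- The operator norm is at most the trace norm. -/
theorem enorm_le_traceNorm (A : H →L[ℂ] H) : ‖A‖ₑ ≤ traceNorm A := by
  obtain ⟨U, hU, hA, -⟩ := exists_polar A
  obtain ⟨S, hS, hSS, hn⟩ := traceNorm_eq A
  rcases eq_or_ne (traceNorm A) ∞ with h | h
  · rw [h]; exact le_top
  have hx : ∀ x, ‖S x‖ ^ 2 ≤ (traceNorm A).toReal * ‖x‖ ^ 2 := by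
    intro x
    have h1 := enorm_sq_le_hs S (basis H) x
    rw [← hn] at h1
    have h2 := ENNReal.toReal_mono (ENNReal.mul_ne_top h (ENNReal.pow_ne_top enorm_ne_top)) h1
    simpa using h2
  have hSn : ‖S‖ ≤ √(traceNorm A).toReal := by
    refine ContinuousLinearMap.opNorm_le_bound _ (Real.sqrt_nonneg _) fun x => ?_
    refine (sq_le_sq₀ (by positivity) (by positivity)).1 ?_
    rw [mul_pow, Real.sq_sqrt ENNReal.toReal_nonneg]
    exact hx x
  rw [← ofReal_norm]
  refine ENNReal.ofReal_le_of_le_toReal ?_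
  calc ‖A‖ = ‖U * (S * S)‖ := by rw [hSS, ← hA]
    _ ≤ ‖U‖ * (‖S‖ * ‖S‖) := (norm_mul_le _ _).trans (by gcongr; exact norm_mul_le _ _)
    _ ≤ 1 * (√(traceNorm A).toReal * √(traceNorm A).toReal) := by gcongr
    _ = (traceNorm A).toReal := by rw [one_mul, Real.mul_self_sqrt ENNReal.toReal_nonneg]

/-- An operator whose matrix elements come from a bounded functional on `B(H)` is trace class. -/
theorem traceNorm_le_of_functional (A : H →L[ℂ] H) (L : (H →L[ℂ] H) →ₗ[ℂ] ℂ) {C : ℝ}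
    (hC : 0 ≤ C) (hL : ∀ W, ‖L W‖ ≤ C * ‖W‖) (hA : ∀ x y, ⟪x, A y⟫_ℂ = L (rankOne ℂ y x)) :
    traceNorm A ≤ ENNReal.ofReal C := by
  obtain ⟨U, hU, h⟩ := traceNorm_le_of_polar A
  rw [h]
  refine ENNReal.summable.tsum_le_of_sum_le fun s => ?_
  set b := basis H
  let z : basisIndex H → ℂ := fun i => ⟪b i, (star U * A) (b i)⟫_ℂ
  have hz : ∀ i, z i = L (rankOne ℂ (b i) (U (b i))) := by
    intro i
    rw [← hA]
    simp only [z, mul_apply_eq_comp, ContinuousLinearMap.star_eq_adjoint,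
      ContinuousLinearMap.adjoint_inner_right]
  -- The phases turn each `z i` into its modulus, so the partial sum of moduli becomes a single
  -- value `L W`. Where `z i = 0` the quotient is `0 / 0 = 0`, which is still bounded by one.
  let ζ : basisIndex H → ℂ := fun i => starRingEnd ℂ (z i) / ‖z i‖
  have hζ : ∀ i, ‖ζ i‖ ≤ 1 := by
    intro i
    simp only [ζ, norm_div, RCLike.norm_conj, Complex.norm_real, norm_norm]
    exact div_self_le_one _
  have hζz : ∀ i, ζ i * z i = ‖z i‖ := by
    intro i
    rcases eq_or_ne (z i) 0 with h0 | h0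
    · simp [h0]
    · have : (‖z i‖ : ℂ) ≠ 0 := by simpa using h0
      simp only [ζ]
      rw [div_mul_eq_mul_div, Complex.conj_mul', sq, mul_div_cancel_right₀ _ this]
  -- `W` is a contraction by Bessel's inequality: its coefficients are those of `U* x`, multiplied
  -- by numbers of modulus at most one.
  let W : H →L[ℂ] H := ∑ i ∈ s, ζ i • rankOne ℂ (b i) (U (b i))
  have hW : ‖W‖ ≤ 1 := by
    refine ContinuousLinearMap.opNorm_le_bound _ zero_le_one fun x => ?_
    refine (sq_le_sq₀ (by positivity) (by positivity)).1 ?_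
    have h1 : W x = ∑ i ∈ s, (ζ i * ⟪b i, (star U) x⟫_ℂ) • b i := by
      simp only [W, sum_apply, smul_apply, rankOne_apply,
        ContinuousLinearMap.star_eq_adjoint, ContinuousLinearMap.adjoint_inner_right, mul_smul]
    have h2 : ‖W x‖ ^ 2 = ∑ i ∈ s, ‖ζ i * ⟪b i, (star U) x⟫_ℂ‖ ^ 2 := by
      rw [← inner_self_eq_norm_sq (𝕜 := ℂ), h1, b.orthonormal.inner_sum, map_sum]
      refine Finset.sum_congr rfl fun i _ => ?_
      rw [RCLike.conj_mul]
      norm_cast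
    rw [h2, one_mul]
    calc ∑ i ∈ s, ‖ζ i * ⟪b i, (star U) x⟫_ℂ‖ ^ 2 ≤ ∑ i ∈ s, ‖⟪b i, (star U) x⟫_ℂ‖ ^ 2 := by
          refine Finset.sum_le_sum fun i _ => ?_
          rw [norm_mul]
          gcongr
          exact mul_le_of_le_one_left (norm_nonneg _) (hζ i)
      _ ≤ ‖(star U) x‖ ^ 2 := b.orthonormal.sum_inner_products_le _
      _ ≤ ‖x‖ ^ 2 := by
          gcongr
          refine ((star U).le_opNorm x).trans (mul_le_of_le_one_left (norm_nonneg _) ?_)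
          rw [norm_star]
          rwa [← ofReal_norm, ENNReal.ofReal_le_one] at hU
  calc ∑ i ∈ s, ‖z i‖ₑ = ENNReal.ofReal (∑ i ∈ s, ‖z i‖) := by
        rw [ENNReal.ofReal_sum_of_nonneg fun _ _ => norm_nonneg _]
        simp only [ofReal_norm]
    _ ≤ ENNReal.ofReal C := by
        refine ENNReal.ofReal_le_ofReal ?_
        have h1 : ((∑ i ∈ s, ‖z i‖ : ℝ) : ℂ) = L W := by
          simp only [W, map_sum, map_smul, ← hz, smul_eq_mul, hζz, Complex.ofReal_sum]
        have h2 : ∑ i ∈ s, ‖z i‖ = ‖L W‖ := by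
          rw [← h1, Complex.norm_real,
            Real.norm_of_nonneg (Finset.sum_nonneg fun _ _ => norm_nonneg _)]
        rw [h2]
        exact (hL W).trans (mul_le_of_le_one_right hC hW)

/-- The matrix elements come from the functional `W ↦ ⟪y, W x⟫`, whose norm is at most `‖x‖ ‖y‖`. -/
theorem traceNorm_rankOne_le (x y : H) : traceNorm (rankOne ℂ x y) ≤ ‖x‖ₑ * ‖y‖ₑ := by
  let L : (H →L[ℂ] H) →ₗ[ℂ] ℂ :=
    { toFun := fun W => ⟪y, W x⟫_ℂ
      map_add' := fun V W => by simp
      map_smul' := fun c W => by simp }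
  have h := traceNorm_le_of_functional (rankOne ℂ x y) L (C := ‖x‖ * ‖y‖) (by positivity)
    (fun W => ?_) fun x' y' => ?_
  · rwa [ENNReal.ofReal_mul (norm_nonneg _), ofReal_norm, ofReal_norm] at h
  · refine (norm_inner_le_norm _ _).trans ?_
    calc ‖y‖ * ‖W x‖ ≤ ‖y‖ * (‖W‖ * ‖x‖) := by gcongr; exact W.le_opNorm x
      _ = ‖x‖ * ‖y‖ * ‖W‖ := by ring
  · simp [L, rankOne_apply, mul_comm]

/-- The trace norm is lower semicontinuous for the operator norm. -/
theorem traceNorm_le_of_tendsto {α : Type*} {l : Filter α} [l.NeBot] {A : α → H →L[ℂ] H}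
    {B : H →L[ℂ] H} (h : Filter.Tendsto A l (𝓝 B)) {C : ℝ≥0∞}
    (hC : ∀ᶠ a in l, traceNorm (A a) ≤ C) : traceNorm B ≤ C := by
  obtain ⟨U, hU, hB⟩ := traceNorm_le_of_polar B
  rw [hB]
  refine ENNReal.summable.tsum_le_of_sum_le fun s => ?_
  -- With `U` fixed by the limit `B`, a finite partial sum is norm continuous in the operator and is
  -- bounded by the trace norm of each `A a`.
  have hcont : Continuous fun T : H →L[ℂ] H =>
      ∑ i ∈ s, ‖⟪basis H i, (star U * T) (basis H i)⟫_ℂ‖ₑ := by fun_prop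
  refine le_of_tendsto ((hcont.tendsto B).comp h) (hC.mono fun a ha => ?_)
  refine le_trans ?_ ha
  exact (ENNReal.sum_le_tsum s).trans (tsum_inner_mul_le _ _ (by rwa [enorm_star]))

end Operators

/-! ### `T(H)` as a Banach space, density of finite-rank operators, and the trace -/

namespace TraceClass

variable {H : Type u} [NormedAddCommGroup H] [InnerProductSpace ℂ H] [CompleteSpace H]

theorem norm_le_of_traceNorm_le {X : TraceClass H} {C : ℝ} (hC : 0 ≤ C)
    (h : traceNorm X.op ≤ ENNReal.ofReal C) : ‖X‖ ≤ C := by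
  rw [norm_def]
  exact ENNReal.toReal_le_of_le_ofReal hC h

theorem enorm_eq (X : TraceClass H) : traceNorm X.op = ENNReal.ofReal ‖X‖ := by
  rw [norm_def, ENNReal.ofReal_toReal X.traceNorm_op_ne_top]

theorem norm_op_le (X : TraceClass H) : ‖X.op‖ ≤ ‖X‖ := by
  have h := enorm_le_traceNorm X.op
  rw [enorm_eq, ← ofReal_norm] at h
  exact (ENNReal.ofReal_le_ofReal_iff (norm_nonneg _)).1 h

variable (H) in
/-- The inclusion of `T(H)` in `B(H)`. -/
noncomputable def opL : TraceClass H →L[ℂ] H →L[ℂ] H :=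
  LinearMap.mkContinuous
    { toFun := op, map_add' := op_add, map_smul' := op_smul } 1 fun X => by
      rw [one_mul]; exact norm_op_le X

@[simp] theorem opL_apply (X : TraceClass H) : opL H X = X.op := rfl

@[simp] theorem op_sub (X Y : TraceClass H) : (X - Y).op = X.op - Y.op := map_sub (opL H) X Y

/-- A trace-norm Cauchy sequence converges in operator norm. Lower semicontinuity of the trace norm
then shows that the limit is trace class and that convergence holds in trace norm. -/
instance : CompleteSpace (TraceClass H) := by
  refine Metric.complete_of_cauchySeq_tendsto fun X hX => ?_
  obtain ⟨A, hA⟩ := cauchySeq_tendsto_of_complete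
    ((opL H).uniformContinuous.comp_cauchySeq hX)
  have key : ∀ ε > 0, ∃ n₀, ∀ n ≥ n₀, traceNorm (X n).op ≠ ∞ ∧
      traceNorm (A - (X n).op) ≤ ENNReal.ofReal ε := by
    intro ε hε
    obtain ⟨n₀, h₀⟩ := Metric.cauchySeq_iff.1 hX ε hε
    refine ⟨n₀, fun n hn => ⟨(X n).traceNorm_op_ne_top, ?_⟩⟩
    refine traceNorm_le_of_tendsto (hA.sub_const (X n).op)
      (Filter.eventually_atTop.2 ⟨n₀, fun m hm => ?_⟩)
    have h1 := (h₀ m hm n hn).le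
    rw [dist_eq_norm] at h1
    change traceNorm ((X m).op - (X n).op) ≤ _
    rw [← op_sub, enorm_eq]
    exact ENNReal.ofReal_le_ofReal h1
  obtain ⟨n₀, h₀⟩ := key 1 one_pos
  have hAt : traceNorm A ≠ ∞ := by
    have h1 := h₀ n₀ le_rfl
    have h2 := traceNorm_add_le (A - (X n₀).op) (X n₀).op
    rw [sub_add_cancel] at h2
    exact ne_top_of_le_ne_top
      (ENNReal.add_ne_top.2 ⟨ne_top_of_le_ne_top ENNReal.ofReal_ne_top h1.2, h1.1⟩) h2
  let Y : TraceClass H := ⟨A, hAt⟩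
  have hY : Y.op = A := rfl
  refine ⟨Y, Metric.tendsto_atTop.2 fun ε hε => ?_⟩
  obtain ⟨n₁, h₁⟩ := key (ε / 2) (half_pos hε)
  refine ⟨n₁, fun n hn => ?_⟩
  rw [dist_eq_norm, norm_sub_rev]
  refine lt_of_le_of_lt (norm_le_of_traceNorm_le (half_pos hε).le ?_) (half_lt_self hε)
  rw [op_sub, hY]
  exact (h₁ n hn).2

/-- The operator `z ↦ ⟨y, z⟩ x`, as a trace-class operator. -/
noncomputable def ketBra (x y : H) : TraceClass H :=
  ⟨rankOne ℂ x y, ne_top_of_le_ne_top (ENNReal.mul_ne_top enorm_ne_top enorm_ne_top)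
    (traceNorm_rankOne_le x y)⟩

@[simp] theorem op_ketBra (x y : H) : (ketBra x y).op = rankOne ℂ x y := rfl

theorem norm_ketBra_le (x y : H) : ‖ketBra x y‖ ≤ ‖x‖ * ‖y‖ := by
  refine norm_le_of_traceNorm_le (by positivity) ?_
  rw [ENNReal.ofReal_mul (norm_nonneg _), ofReal_norm, ofReal_norm]
  exact traceNorm_rankOne_le x y

variable (H) in
/-- `ketBra` as a continuous sesquilinear map. -/
noncomputable def ketBraL : H →L[ℂ] H →L⋆[ℂ] TraceClass H :=
  LinearMap.mkContinuous₂
    (LinearMap.mk₂'ₛₗ (RingHom.id ℂ) (starRingEnd ℂ) ketBra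
      (fun _ _ _ => op_injective (by simp)) (fun _ _ _ => op_injective (by simp))
      (fun _ _ _ => op_injective (by simp)) (fun _ _ _ => op_injective (by simp))) 1
    fun x y => by rw [one_mul]; exact norm_ketBra_le x y

@[simp] theorem ketBraL_apply (x y : H) : ketBraL H x y = ketBra x y := rfl

/-- A trace-class operator is the sum of its columns, in trace norm. -/
theorem hasSum_ketBra {ι : Type u} (b : HilbertBasis ι ℂ H) (X : TraceClass H) :
    HasSum (fun i => ketBra (X.op (b i)) (b i)) X := by
  classical
  obtain ⟨U, -, hA, -⟩ := exists_polar X.op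
  obtain ⟨S, hS, hSS, hn⟩ := traceNorm_eq X.op
  have hfin : ∑' i, ‖S (b i)‖ₑ ^ 2 ≠ ∞ := by rw [← hn]; exact X.traceNorm_op_ne_top
  set c : ℝ≥0∞ := (∑' i, ‖(U * S) (b i)‖ₑ ^ 2) ^ (1 / 2 : ℝ)
  have hc : c ≠ ∞ := ENNReal.rpow_ne_top_of_nonneg (by norm_num) (ne_top_of_le_ne_top
    (ENNReal.mul_ne_top (ENNReal.pow_ne_top enorm_ne_top) hfin) (hs_comp_le b U S))
  have hbound : ∀ s : Finset ι, traceNorm (∑ i ∈ s, ketBra (X.op (b i)) (b i) - X).op ≤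
      c * (∑' i : { i // i ∉ s }, ‖S (b i)‖ₑ ^ 2) ^ (1 / 2 : ℝ) := by
    intro s
    -- `P` projects onto the complement of the vectors indexed by `s`, so the error is `-X P = -(U
    -- S)(S P)`. The Hilbert–Schmidt norm of `S P` is a tail of the convergent series for `S`.
    let P : H →L[ℂ] H := 1 - ∑ i ∈ s, rankOne ℂ (b i) (b i)
    have hP : ∀ i, P (b i) = if i ∈ s then 0 else b i := by
      intro i
      simp only [P, sub_apply, one_apply_eq_self, sum_apply, rankOne_apply,
        orthonormal_iff_ite.1 b.orthonormal, ite_smul, one_smul, zero_smul]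
      rw [Finset.sum_ite_eq']
      split_ifs <;> simp
    have h1 : (∑ i ∈ s, ketBra (X.op (b i)) (b i) - X).op = -((U * S) * (S * P)) := by
      have h2 : (U * S) * (S * P) = X.op * P := by
        rw [mul_assoc, ← mul_assoc S, hSS, ← mul_assoc, ← hA]
      rw [h2, op_sub, ← opL_apply, map_sum]
      ext x
      simp [P]
    rw [h1, traceNorm_neg]
    refine (traceNorm_mul_le_hs b _ _).trans ?_
    gcongr
    refine le_of_eq ?_
    have h3 := tsum_subtype {i | i ∉ s} fun i => ‖S (b i)‖ₑ ^ 2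
    refine Eq.trans (tsum_congr fun i => ?_) h3.symm
    by_cases hi : i ∈ s <;> simp [hP, hi]
  rw [HasSum, tendsto_iff_norm_sub_tendsto_zero]
  have hlim : Filter.Tendsto
      (fun s : Finset ι => c * (∑' i : { i // i ∉ s }, ‖S (b i)‖ₑ ^ 2) ^ (1 / 2 : ℝ))
      Filter.atTop (𝓝 0) := by
    have h1 := (ENNReal.tendsto_tsum_compl_atTop_zero hfin).ennrpow_const (1 / 2 : ℝ)
    rw [ENNReal.zero_rpow_of_pos (by norm_num)] at h1
    have h2 := ENNReal.Tendsto.const_mul h1 (Or.inr hc)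
    rwa [mul_zero] at h2
  have h3 := tendsto_of_tendsto_of_tendsto_of_le_of_le tendsto_const_nhds hlim
    (fun _ => zero_le) hbound
  have h4 := (ENNReal.tendsto_toReal ENNReal.zero_ne_top).comp h3
  exact h4

/-- Continuous linear maps on `T(H)` agree if they do on rank-one operators. -/
theorem clm_ext {E : Type*} [AddCommGroup E] [Module ℂ E] [TopologicalSpace E] [T2Space E]
    {f g : TraceClass H →L[ℂ] E} (h : ∀ x y, f (ketBra x y) = g (ketBra x y)) : f = g := by
  ext X
  have h1 := (hasSum_ketBra (basis H) X).mapL f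
  simp only [h] at h1
  exact h1.unique ((hasSum_ketBra (basis H) X).mapL g)

variable (H) in
/-- The trace, as a continuous functional on `T(H)`. -/
noncomputable def traceL : TraceClass H →L[ℂ] ℂ :=
  LinearMap.mkContinuous
    { toFun := fun X => trace X.op
      map_add' := fun X Y => by
        have hX := (summable_inner X.op X.traceNorm_op_ne_top).of_norm
        have hY := (summable_inner Y.op Y.traceNorm_op_ne_top).of_norm
        simp only [trace, op_add, add_apply, inner_add_right]
        exact hX.tsum_add hY
      map_smul' := fun c X => by
        simp only [trace, op_smul, smul_apply, inner_smul_right, tsum_mul_left,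
          RingHom.id_apply, smul_eq_mul] } 1 fun X => by
      have hX := summable_inner X.op X.traceNorm_op_ne_top
      have h := tsum_inner_mul_le (1 : H →L[ℂ] H) X.op enorm_one_le
      rw [one_mul, enorm_eq] at h
      refine (norm_tsum_le_tsum_norm hX).trans ?_
      rw [one_mul]
      have h2 : ENNReal.ofReal (∑' i, ‖⟪basis H i, X.op (basis H i)⟫_ℂ‖) ≤ ENNReal.ofReal ‖X‖ := by
        rw [ENNReal.ofReal_tsum_of_nonneg (fun _ => norm_nonneg _) hX]
        simpa only [ofReal_norm] using h
      exact (ENNReal.ofReal_le_ofReal_iff (norm_nonneg _)).1 h2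

@[simp] theorem traceL_apply (X : TraceClass H) : traceL H X = trace X.op := rfl

theorem norm_trace_le (X : TraceClass H) : ‖trace X.op‖ ≤ ‖X‖ := by
  refine ((traceL H).le_opNorm X).trans (mul_le_of_le_one_left (norm_nonneg _) ?_)
  exact LinearMap.mkContinuous_norm_le _ zero_le_one _

end TraceClass

theorem trace_rankOne {H : Type u} [NormedAddCommGroup H] [InnerProductSpace ℂ H]
    [CompleteSpace H] (x y : H) : trace (rankOne ℂ x y) = ⟪y, x⟫_ℂ := by
  rw [← (basis H).tsum_inner_mul_inner y x]
  simp [trace, rankOne_apply]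

/-! ### Multiplication by bounded operators and cyclicity of the trace -/

namespace TraceClass

variable {H : Type u} [NormedAddCommGroup H] [InnerProductSpace ℂ H] [CompleteSpace H]

variable (H) in
/-- Left multiplication of trace-class operators by bounded operators. -/
noncomputable def lmulL : (H →L[ℂ] H) →L[ℂ] TraceClass H →L[ℂ] TraceClass H :=
  LinearMap.mkContinuous₂
    (LinearMap.mk₂ ℂ lmul
      (fun _ _ _ => op_injective (by simp [op_lmul, add_mul]))
      (fun _ _ _ => op_injective (by simp [op_lmul]))
      (fun _ _ _ => op_injective (by simp [op_lmul, mul_add]))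
      (fun _ _ _ => op_injective (by simp [op_lmul]))) 1
    fun F X => by
      rw [one_mul]
      refine norm_le_of_traceNorm_le (by positivity) ?_
      rw [ENNReal.ofReal_mul (norm_nonneg _), ofReal_norm, ← enorm_eq]
      exact traceNorm_mul_le F X.op

@[simp] theorem lmulL_apply (F : H →L[ℂ] H) (X : TraceClass H) : lmulL H F X = lmul F X := rfl

theorem norm_lmul_le (F : H →L[ℂ] H) (X : TraceClass H) : ‖lmul F X‖ ≤ ‖F‖ * ‖X‖ := by
  refine norm_le_of_traceNorm_le (by positivity) ?_
  rw [ENNReal.ofReal_mul (norm_nonneg _), ofReal_norm, ← enorm_eq]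
  exact traceNorm_mul_le F X.op

theorem lmul_ketBra (F : H →L[ℂ] H) (x y : H) : lmul F (ketBra x y) = ketBra (F x) y :=
  op_injective (InnerProductSpace.comp_rankOne x y F)

theorem norm_star_eq (X : TraceClass H) : ‖star X‖ = ‖X‖ := by
  have h : ∀ Y : TraceClass H, ‖star Y‖ ≤ ‖Y‖ := fun Y => by
    refine norm_le_of_traceNorm_le (norm_nonneg _) ?_
    rw [← enorm_eq]
    exact traceNorm_star_le Y.op
  refine le_antisymm (h X) ?_
  have h2 : star (star X) = X := op_injective (by simp [op_star])
  conv_lhs => rw [← h2]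
  exact h _

/-- Right multiplication of trace-class operators by a bounded operator. -/
noncomputable def rmul (X : TraceClass H) (F : H →L[ℂ] H) : TraceClass H := star (lmul (star F) (star X))

@[simp] theorem op_rmul (X : TraceClass H) (F : H →L[ℂ] H) : (rmul X F).op = X.op * F := by
  simp [rmul, op_star, op_lmul]

theorem trace_star (X : TraceClass H) : trace (star X).op = starRingEnd ℂ (trace X.op) := by
  rw [trace, trace, Complex.conj_tsum]
  refine tsum_congr fun i => ?_
  rw [op_star, ContinuousLinearMap.star_eq_adjoint, ContinuousLinearMap.adjoint_inner_right,
    inner_conj_symm]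

/-- Cyclicity of the trace. -/
theorem trace_mul_comm (F : H →L[ℂ] H) (X : TraceClass H) :
    trace (F * X.op) = trace (X.op * F) := by
  let r : TraceClass H →L[ℂ] TraceClass H :=
    LinearMap.mkContinuous
      { toFun := fun X => rmul X F
        map_add' := fun X Y => op_injective (by simp [add_mul])
        map_smul' := fun c X => op_injective (by simp) } ‖F‖ fun X => by
      change ‖star (lmul (star F) (star X))‖ ≤ _
      rw [norm_star_eq]
      refine (norm_lmul_le _ _).trans ?_
      rw [norm_star, norm_star_eq]
  -- Both sides are continuous in `X`, so cyclicity reduces to rank-one operators, where it says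
  -- `⟪y, F x⟫ = ⟪F* y, x⟫`.
  have h : (traceL H).comp (lmulL H F) = (traceL H).comp r := by
    refine clm_ext fun x y => ?_
    change trace (F * rankOne ℂ x y) = trace (rmul (ketBra x y) F).op
    have h1 : F * rankOne ℂ x y = rankOne ℂ (F x) y := InnerProductSpace.comp_rankOne x y F
    have h2 : rankOne ℂ x y * F = rankOne ℂ x (star F y) := InnerProductSpace.rankOne_comp x y F
    rw [op_rmul, op_ketBra, h1, h2, trace_rankOne, trace_rankOne,
      ContinuousLinearMap.star_eq_adjoint, ContinuousLinearMap.adjoint_inner_left]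
  have h3 := congrArg (fun f => f X) h
  change trace (F * X.op) = trace (rmul X F).op at h3
  rwa [op_rmul] at h3

end TraceClass

end SEB

namespace SEB

open InnerProductSpace (rankOne rankOne_apply)

/-! ### Trace duality and positivity -/

section Duality

variable {H : Type u} [NormedAddCommGroup H] [InnerProductSpace ℂ H] [CompleteSpace H]

/-- Bounded sesquilinear forms come from bounded operators. -/
theorem exists_op_of_sesq (g : H →L[ℂ] H →L⋆[ℂ] ℂ) :
    ∃ A : H →L[ℂ] H, ∀ x y, ⟪x, A y⟫_ℂ = g y x := by
  refine ⟨(InnerProductSpace.continuousLinearMapOfBilin g.flip).adjoint, fun x y => ?_⟩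
  rw [ContinuousLinearMap.adjoint_inner_right,
    InnerProductSpace.continuousLinearMapOfBilin_apply, ContinuousLinearMap.flip_apply]

theorem op_ext_inner {A B : H →L[ℂ] H} (h : ∀ x y, ⟪x, A y⟫_ℂ = ⟪x, B y⟫_ℂ) : A = B :=
  ContinuousLinearMap.ext fun y => ext_inner_left ℂ fun x => h x y

theorem exists_star_mul_self_eq {F : H →L[ℂ] H} (hF : F.IsPositive) :
    ∃ T : H →L[ℂ] H, star T * T = F := by
  have h := (ContinuousLinearMap.nonneg_iff_isPositive F).2 hF
  refine ⟨CFC.sqrt F, ?_⟩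
  rw [(IsSelfAdjoint.of_nonneg (CFC.sqrt_nonneg F)).star_eq, CFC.sqrt_mul_sqrt_self F h]

theorem isPositive_star_mul_self (T : H →L[ℂ] H) : (star T * T).IsPositive :=
  (ContinuousLinearMap.nonneg_iff_isPositive _).1 (star_mul_self_nonneg T)

theorem isPositive_of_inner_nonneg {A : H →L[ℂ] H} (h : ∀ x, 0 ≤ ⟪x, A x⟫_ℂ) : A.IsPositive := by
  rw [ContinuousLinearMap.isPositive_iff_complex]
  intro x
  have h1 : 0 ≤ ⟪A x, x⟫_ℂ := by
    rw [← inner_conj_symm]; exact star_nonneg_iff.2 (h x)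
  obtain ⟨h2, h3⟩ := Complex.nonneg_iff.1 h1
  exact ⟨Complex.ext rfl h3, h2⟩

theorem isPositive_rankOne_self (x : H) : (rankOne ℂ x x).IsPositive := by
  refine isPositive_of_inner_nonneg fun y => ?_
  rw [rankOne_apply, inner_smul_right, mul_comm, ← inner_conj_symm]
  exact star_mul_self_nonneg _

namespace TraceClass

/-- Trace duality: continuous functionals on `T(H)` are given by bounded operators. -/
theorem exists_trace_lmul_eq (f : TraceClass H →L[ℂ] ℂ) :
    ∃ B : H →L[ℂ] H, ∀ X, f X = trace (lmul B X).op := by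
  -- The values of `f` on rank-one operators form a bounded sesquilinear form, and its operator is
  -- the required `B`.
  obtain ⟨B, hB⟩ := exists_op_of_sesq
    ((ContinuousLinearMap.compSL H (TraceClass H) ℂ (starRingEnd ℂ) (RingHom.id ℂ) f).comp
      (ketBraL H))
  refine ⟨B, fun X => ?_⟩
  have h : f = (traceL H).comp (lmulL H B) := by
    refine clm_ext fun x y => ?_
    rw [ContinuousLinearMap.comp_apply, lmulL_apply, lmul_ketBra, traceL_apply, op_ketBra,
      trace_rankOne, hB]
    rfl
  rw [h]
  rfl

/-- A bounded functional on `B(H)` restricts to finite-rank operators as a trace-class operator. -/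
theorem exists_of_functional (L : (H →L[ℂ] H) →L[ℂ] ℂ) :
    ∃ X : TraceClass H, (∀ x y, ⟪x, X.op y⟫_ℂ = L (rankOne ℂ y x)) ∧ ‖X‖ ≤ ‖L‖ := by
  obtain ⟨A, hA⟩ := exists_op_of_sesq
    ((ContinuousLinearMap.compSL H (H →L[ℂ] H) ℂ (starRingEnd ℂ) (RingHom.id ℂ) L).comp
      (rankOne ℂ))
  have h := traceNorm_le_of_functional A L.toLinearMap (norm_nonneg L) L.le_opNorm hA
  let X : TraceClass H := ⟨A, ne_top_of_le_ne_top ENNReal.ofReal_ne_top h⟩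
  exact ⟨X, hA, norm_le_of_traceNorm_le (norm_nonneg L) h⟩

variable (H) in
/-- The normal part of a functional on `B(H)`. -/
noncomputable def ofFunctional : ((H →L[ℂ] H) →L[ℂ] ℂ) →L[ℂ] TraceClass H :=
  LinearMap.mkContinuous
    { toFun := fun L => (exists_of_functional L).choose
      map_add' := fun L M => op_injective <| op_ext_inner fun x y => by
        rw [op_add, add_apply, inner_add_right, (exists_of_functional (L + M)).choose_spec.1,
          (exists_of_functional L).choose_spec.1, (exists_of_functional M).choose_spec.1,
          add_apply]
      map_smul' := fun c L => op_injective <| op_ext_inner fun x y => by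
        rw [op_smul, smul_apply, inner_smul_right, (exists_of_functional (c • L)).choose_spec.1,
          (exists_of_functional L).choose_spec.1, smul_apply]
        rfl } 1
    fun L => by rw [one_mul]; exact (exists_of_functional L).choose_spec.2

theorem inner_ofFunctional (L : (H →L[ℂ] H) →L[ℂ] ℂ) (x y : H) :
    ⟪x, (ofFunctional H L).op y⟫_ℂ = L (rankOne ℂ y x) :=
  (exists_of_functional L).choose_spec.1 x y

theorem norm_ofFunctional_le (L : (H →L[ℂ] H) →L[ℂ] ℂ) : ‖ofFunctional H L‖ ≤ ‖L‖ :=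
  (exists_of_functional L).choose_spec.2

/-- Cyclicity gives `Tr (T* T X) = Tr (T X T*)`. Expanded in the basis, every term is a diagonal
value of `X`, so positivity of `X`, or of a block matrix of such operators, can be used term by
term. -/
theorem trace_star_mul_self_mul (T : H →L[ℂ] H) (X : TraceClass H) :
    HasSum (fun i => ⟪star T (basis H i), X.op (star T (basis H i))⟫_ℂ)
      (trace (lmul (star T * T) X).op) := by
  have h := trace_mul_comm (star T) (lmul T X)
  rw [op_lmul, ← mul_assoc, ← op_lmul T X, ← op_rmul] at h
  rw [op_lmul, h]
  have h1 := (summable_inner _ (rmul (lmul T X) (star T)).traceNorm_op_ne_top).of_norm.hasSum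
  have h2 : ∀ i, ⟪basis H i, (rmul (lmul T X) (star T)).op (basis H i)⟫_ℂ =
      ⟪star T (basis H i), X.op (star T (basis H i))⟫_ℂ := by
    intro i
    rw [op_rmul, op_lmul, mul_assoc, ContinuousLinearMap.star_eq_adjoint,
      ContinuousLinearMap.adjoint_inner_left]
    rfl
  simp only [h2] at h1
  rw [trace]
  simp only [h2]
  exact h1

theorem trace_lmul_nonneg {F : H →L[ℂ] H} (hF : F.IsPositive) {X : TraceClass H}
    (hX : X.op.IsPositive) : 0 ≤ trace (lmul F X).op := by
  obtain ⟨T, rfl⟩ := exists_star_mul_self_eq hF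
  exact (trace_star_mul_self_mul T X).nonneg fun i => hX.inner_nonneg_right _

/-- Since `|X| = X`, the series for the trace norm and for the trace coincide. -/
theorem norm_eq_trace_of_isPositive {X : TraceClass H} (hX : X.op.IsPositive) :
    (‖X‖ : ℂ) = trace X.op := by
  have habs : CFC.abs X.op = X.op :=
    CFC.abs_of_nonneg _ ((ContinuousLinearMap.nonneg_iff_isPositive _).2 hX)
  have hre : ∀ i, (RCLike.re ⟪basis H i, X.op (basis H i)⟫_ℂ : ℂ) =
      ⟪basis H i, X.op (basis H i)⟫_ℂ := fun i =>
    RCLike.nonneg_iff_exists_ofReal.1 (hX.inner_nonneg_right (basis H i)) |>.elim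
      fun r hr => by rw [← hr.2]; simp
  rw [trace, norm_def, traceNorm, habs, ← ENNReal.ofReal_tsum_of_nonneg, ENNReal.toReal_ofReal,
    Complex.ofReal_tsum]
  · exact tsum_congr hre
  · exact tsum_nonneg fun i => hX.re_inner_nonneg_right _
  · exact fun i => hX.re_inner_nonneg_right _
  · exact (Complex.reCLM.summable (summable_inner _ X.traceNorm_op_ne_top).of_norm)

end TraceClass

end Duality

/-! ### Tensor products of operators and of trace-class operators -/

section Tensor

variable {R : Type u} [NormedAddCommGroup R] [InnerProductSpace ℂ R]
variable {H : Type v} [NormedAddCommGroup H] [InnerProductSpace ℂ H]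

/-- Continuous semilinear maps on the tensor product agree if they do on elementary tensors. -/
theorem tensor_clm_ext {σ : ℂ →+* ℂ} {E : Type*} [AddCommGroup E] [Module ℂ E]
    [TopologicalSpace E] [T2Space E] {f g : HilbertTensor R H →SL[σ] E}
    (h : ∀ x y, f ((x ⊗ₜ[ℂ] y : R ⊗[ℂ] H) : HilbertTensor R H) =
      g ((x ⊗ₜ[ℂ] y : R ⊗[ℂ] H) : HilbertTensor R H)) : f = g := by
  ext z
  induction z using UniformSpace.Completion.induction_on with
  | hp => exact isClosed_eq f.continuous g.continuous
  | ih z =>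
    induction z using TensorProduct.induction_on with
    | zero => rw [UniformSpace.Completion.coe_zero, map_zero, map_zero]
    | tmul x y => exact h x y
    | add a b ha hb => rw [UniformSpace.Completion.coe_add, map_add, map_add, ha, hb]

theorem inner_coe_tmul (x x' : R) (y y' : H) :
    ⟪((x ⊗ₜ[ℂ] y : R ⊗[ℂ] H) : HilbertTensor R H),
      ((x' ⊗ₜ[ℂ] y' : R ⊗[ℂ] H) : HilbertTensor R H)⟫_ℂ = ⟪x, x'⟫_ℂ * ⟪y, y'⟫_ℂ := by
  rw [UniformSpace.Completion.inner_coe, TensorProduct.inner_tmul]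

theorem norm_tensorOp_le (A : R →L[ℂ] R) (B : H →L[ℂ] H) : ‖tensorOp A B‖ ≤ ‖A‖ * ‖B‖ := by
  refine ContinuousLinearMap.opNorm_le_bound _ (by positivity) fun z => ?_
  induction z using UniformSpace.Completion.induction_on with
  | hp => exact isClosed_le (by fun_prop) (by fun_prop)
  | ih z =>
    rw [tensorOp, ContinuousLinearMap.completion_apply_coe, UniformSpace.Completion.norm_coe,
      UniformSpace.Completion.norm_coe]
    exact ((TensorProduct.mapL A B).le_opNorm z).trans
      (mul_le_mul_of_nonneg_right (TensorProduct.norm_mapL_le A B) (norm_nonneg _))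

theorem tensorOp_add_left (A A' : R →L[ℂ] R) (B : H →L[ℂ] H) :
    tensorOp (A + A') B = tensorOp A B + tensorOp A' B := by
  refine tensor_ext fun x y => ?_
  rw [add_apply, tensorOp_coe_tmul, tensorOp_coe_tmul, tensorOp_coe_tmul, add_apply,
    TensorProduct.add_tmul, UniformSpace.Completion.coe_add]

theorem tensorOp_add_right (A : R →L[ℂ] R) (B B' : H →L[ℂ] H) :
    tensorOp A (B + B') = tensorOp A B + tensorOp A B' := by
  refine tensor_ext fun x y => ?_
  rw [add_apply, tensorOp_coe_tmul, tensorOp_coe_tmul, tensorOp_coe_tmul, add_apply,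
    TensorProduct.tmul_add, UniformSpace.Completion.coe_add]

theorem tensorOp_smul_left (c : ℂ) (A : R →L[ℂ] R) (B : H →L[ℂ] H) :
    tensorOp (c • A) B = c • tensorOp A B := by
  refine tensor_ext fun x y => ?_
  rw [smul_apply, tensorOp_coe_tmul, tensorOp_coe_tmul, smul_apply,
    ← TensorProduct.smul_tmul', UniformSpace.Completion.coe_smul]

theorem tensorOp_smul_right (c : ℂ) (A : R →L[ℂ] R) (B : H →L[ℂ] H) :
    tensorOp A (c • B) = c • tensorOp A B := by
  refine tensor_ext fun x y => ?_
  rw [smul_apply, tensorOp_coe_tmul, tensorOp_coe_tmul, smul_apply,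
    TensorProduct.tmul_smul, UniformSpace.Completion.coe_smul]

theorem tensorOp_one_one : tensorOp (1 : R →L[ℂ] R) (1 : H →L[ℂ] H) = 1 := by
  refine tensor_ext fun x y => ?_
  rw [tensorOp_coe_tmul]
  rfl

variable [CompleteSpace R] [CompleteSpace H]

theorem tensorOp_rankOne (x x' : R) (y y' : H) :
    tensorOp (rankOne ℂ x x') (rankOne ℂ y y') =
      rankOne ℂ ((x ⊗ₜ[ℂ] y : R ⊗[ℂ] H) : HilbertTensor R H)
        ((x' ⊗ₜ[ℂ] y' : R ⊗[ℂ] H) : HilbertTensor R H) := by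
  refine tensor_ext fun z w => ?_
  rw [tensorOp_coe_tmul, rankOne_apply, rankOne_apply, rankOne_apply, inner_coe_tmul,
    TensorProduct.smul_tmul_smul, UniformSpace.Completion.coe_smul]

theorem star_tensorOp (A : R →L[ℂ] R) (B : H →L[ℂ] H) :
    star (tensorOp A B) = tensorOp (star A) (star B) := by
  refine tensor_ext fun x y => ext_inner_left ℂ fun z => ?_
  rw [← inner_conj_symm, ← inner_conj_symm z]
  congr 1
  set w := ((x ⊗ₜ[ℂ] y : R ⊗[ℂ] H) : HilbertTensor R H) with hw
  have h : innerSL ℂ ((star (tensorOp A B)) w) = innerSL ℂ (tensorOp (star A) (star B) w) := by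
    refine tensor_clm_ext fun x' y' => ?_
    rw [innerSL_apply_apply, innerSL_apply_apply, ContinuousLinearMap.star_eq_adjoint,
      ContinuousLinearMap.adjoint_inner_left, hw, tensorOp_coe_tmul, tensorOp_coe_tmul,
      inner_coe_tmul, inner_coe_tmul, ContinuousLinearMap.star_eq_adjoint,
      ContinuousLinearMap.star_eq_adjoint, ContinuousLinearMap.adjoint_inner_left,
      ContinuousLinearMap.adjoint_inner_left]
  exact congrArg (fun f => f z) h

/-- If `A = S* S` and `B = T* T`, then `A ⊗ B = (S ⊗ T)* (S ⊗ T)`. -/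
theorem isPositive_tensorOp {A : R →L[ℂ] R} {B : H →L[ℂ] H} (hA : A.IsPositive)
    (hB : B.IsPositive) : (tensorOp A B).IsPositive := by
  obtain ⟨S, rfl⟩ := exists_star_mul_self_eq hA
  obtain ⟨T, rfl⟩ := exists_star_mul_self_eq hB
  rw [tensorOp_mul, ← star_tensorOp]
  exact isPositive_star_mul_self _

/-- The polar parts factor `A ⊗ B` as `(U ⊗ V)(S ⊗ T)(S ⊗ T)` with `U ⊗ V` a contraction, and the
squared Hilbert–Schmidt norm of `S ⊗ T` is the product of the two trace norms. -/
theorem traceNorm_tensorOp_le (A : R →L[ℂ] R) (B : H →L[ℂ] H) :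
    traceNorm (tensorOp A B) ≤ traceNorm A * traceNorm B := by
  obtain ⟨U, hU1, hU, -⟩ := exists_polar A
  obtain ⟨V, hV1, hV, -⟩ := exists_polar B
  obtain ⟨S, -, hS, hSn⟩ := traceNorm_eq A
  obtain ⟨T, -, hT, hTn⟩ := traceNorm_eq B
  have h1 : tensorOp A B = (tensorOp U V * tensorOp S T) * tensorOp S T := by
    conv_lhs => rw [hU, hV, ← hS, ← hT, tensorOp_mul, tensorOp_mul]
    simp only [mul_assoc]
  set d := basis (HilbertTensor R H)
  have h2 : ∑' i, ‖tensorOp S T (d i)‖ₑ ^ 2 = traceNorm A * traceNorm B := by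
    rw [hs_tensorOp (basis R) (basis H), ← hSn, ← hTn]
  have h3 : ‖tensorOp U V‖ₑ ≤ 1 := by
    rw [← ofReal_norm]
    exact ENNReal.ofReal_le_one.2
      ((norm_tensorOp_le U V).trans (mul_le_one₀ hU1 (norm_nonneg _) hV1))
  have h4 : ∑' i, ‖(tensorOp U V * tensorOp S T) (d i)‖ₑ ^ 2 ≤ traceNorm A * traceNorm B := by
    refine (hs_comp_le d _ _).trans ?_
    rw [h2]
    calc _ ≤ 1 * (traceNorm A * traceNorm B) := by gcongr; exact pow_le_one₀ zero_le h3
      _ = _ := one_mul _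
  rw [h1]
  refine (traceNorm_mul_le_hs d _ _).trans ?_
  rw [h2]
  calc _ ≤ (traceNorm A * traceNorm B) ^ (1 / 2 : ℝ) * (traceNorm A * traceNorm B) ^ (1 / 2 : ℝ) :=
        mul_le_mul' (ENNReal.rpow_le_rpow h4 (by norm_num)) le_rfl
    _ = _ := by rw [← ENNReal.rpow_add_of_nonneg _ _ (by norm_num) (by norm_num)]; norm_num

namespace TraceClass

theorem norm_tmul_le (A : TraceClass R) (B : TraceClass H) : ‖A.tmul B‖ ≤ ‖A‖ * ‖B‖ := by
  refine norm_le_of_traceNorm_le (by positivity) ?_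
  rw [ENNReal.ofReal_mul (norm_nonneg _), ← enorm_eq, ← enorm_eq]
  exact traceNorm_tensorOp_le A.op B.op

variable (R H) in
/-- The tensor product of trace-class operators, as a continuous bilinear map. -/
noncomputable def tmulL : TraceClass R →L[ℂ] TraceClass H →L[ℂ] TraceClass (HilbertTensor R H) :=
  LinearMap.mkContinuous₂
    (LinearMap.mk₂ ℂ tmul
      (fun _ _ _ => op_injective (tensorOp_add_left _ _ _))
      (fun _ _ _ => op_injective (tensorOp_smul_left _ _ _))
      (fun _ _ _ => op_injective (tensorOp_add_right _ _ _))
      (fun _ _ _ => op_injective (tensorOp_smul_right _ _ _))) 1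
    fun A B => by rw [one_mul]; exact norm_tmul_le A B

@[simp] theorem tmulL_apply (A : TraceClass R) (B : TraceClass H) : tmulL R H A B = A.tmul B := rfl

theorem ketBra_tmul (x x' : R) (y y' : H) :
    ketBra ((x ⊗ₜ[ℂ] y : R ⊗[ℂ] H) : HilbertTensor R H)
      ((x' ⊗ₜ[ℂ] y' : R ⊗[ℂ] H) : HilbertTensor R H) = (ketBra x x').tmul (ketBra y y') :=
  op_injective (tensorOp_rankOne x x' y y').symm

/-- Continuous linear maps on `T(R ⊗ H)` agree if they do on the operators `A ⊗ B`. -/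
theorem clm_tensor_ext {E : Type*} [AddCommGroup E] [Module ℂ E] [TopologicalSpace E] [T2Space E]
    {f g : TraceClass (HilbertTensor R H) →L[ℂ] E}
    (h : ∀ (A : TraceClass R) (B : TraceClass H), f (A.tmul B) = g (A.tmul B)) : f = g := by
  refine clm_ext fun z w => ?_
  have h1 : f.comp ((ketBraL (HilbertTensor R H)).flip w) =
      g.comp ((ketBraL (HilbertTensor R H)).flip w) := by
    refine tensor_clm_ext fun x y => ?_
    set z' := ((x ⊗ₜ[ℂ] y : R ⊗[ℂ] H) : HilbertTensor R H) with hz'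
    have h2 : f.comp (ketBraL (HilbertTensor R H) z') = g.comp (ketBraL (HilbertTensor R H) z') := by
      refine tensor_clm_ext fun x' y' => ?_
      simp only [ContinuousLinearMap.comp_apply, ketBraL_apply]
      rw [hz', ketBra_tmul, h]
    exact congrArg (fun k => k w) h2
  exact congrArg (fun k => k z) h1

/-- Continuity in each factor separately reduces the claim to rank-one operators, where it is the
product formula for the inner product. -/
theorem trace_tmul (A : TraceClass R) (B : TraceClass H) :
    trace (A.tmul B).op = trace A.op * trace B.op := by
  have h1 : ((traceL (HilbertTensor R H)).comp ((tmulL R H).flip B)) = trace B.op • traceL R := by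
    refine clm_ext fun x x' => ?_
    have h2 : (traceL (HilbertTensor R H)).comp (tmulL R H (ketBra x x')) =
        ⟪x', x⟫_ℂ • traceL H := by
      refine clm_ext fun y y' => ?_
      simp only [ContinuousLinearMap.comp_apply, tmulL_apply, smul_apply, traceL_apply]
      rw [← ketBra_tmul, op_ketBra, trace_rankOne, inner_coe_tmul, op_ketBra, trace_rankOne,
        smul_eq_mul]
    have h3 := congrArg (fun k => k B) h2
    simp only [ContinuousLinearMap.comp_apply, tmulL_apply, smul_apply, traceL_apply,
      ContinuousLinearMap.flip_apply, op_ketBra, trace_rankOne, smul_eq_mul] at h3 ⊢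
    rw [h3, mul_comm]
  have h4 := congrArg (fun k => k A) h1
  simp only [ContinuousLinearMap.comp_apply, tmulL_apply, smul_apply, traceL_apply,
    ContinuousLinearMap.flip_apply, smul_eq_mul] at h4
  rw [h4, mul_comm]

theorem lmul_tmul (V : R →L[ℂ] R) (F : H →L[ℂ] H) (A : TraceClass R) (B : TraceClass H) :
    lmul (tensorOp V F) (A.tmul B) = (lmul V A).tmul (lmul F B) :=
  op_injective (tensorOp_mul V A.op F B.op).symm

/-! ### Weighted partial traces -/

variable (R) in
/-- The functionals `W ↦ Tr ((W ⊗ F) ρ)` on `B(R)`, for `ρ ∈ T(R ⊗ H)`. -/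
noncomputable def sliceFunctional (F : H →L[ℂ] H) :
    TraceClass (HilbertTensor R H) →L[ℂ] (R →L[ℂ] R) →L[ℂ] ℂ :=
  LinearMap.mkContinuous₂
    (LinearMap.mk₂ ℂ (fun ρ W => traceL _ (lmulL _ (tensorOp W F) ρ))
      (fun _ _ _ => by simp only [map_add]) (fun _ _ _ => by simp only [map_smul])
      (fun _ _ _ => by simp only [tensorOp_add_left, map_add, add_apply])
      (fun _ _ _ => by simp only [tensorOp_smul_left, map_smul, smul_apply])) ‖F‖
    fun ρ W => by
      change ‖trace (lmul (tensorOp W F) ρ).op‖ ≤ _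
      refine (norm_trace_le _).trans ((norm_lmul_le _ _).trans ?_)
      calc ‖tensorOp W F‖ * ‖ρ‖ ≤ ‖W‖ * ‖F‖ * ‖ρ‖ := by gcongr; exact norm_tensorOp_le W F
        _ = ‖F‖ * ‖ρ‖ * ‖W‖ := by ring

variable (R) in
/-- The weighted partial trace `ρ ↦ Tr_H ((I ⊗ F) ρ)`. -/
noncomputable def partialTrace (F : H →L[ℂ] H) : TraceClass (HilbertTensor R H) →L[ℂ] TraceClass R :=
  (ofFunctional R).comp (sliceFunctional R F)

theorem inner_partialTrace (F : H →L[ℂ] H) (ρ : TraceClass (HilbertTensor R H)) (x y : R) :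
    ⟪x, (partialTrace R F ρ).op y⟫_ℂ = trace (lmul (tensorOp (rankOne ℂ y x) F) ρ).op :=
  inner_ofFunctional _ x y

theorem norm_partialTrace_le (F : H →L[ℂ] H) : ‖partialTrace R F‖ ≤ ‖F‖ := by
  refine ContinuousLinearMap.opNorm_le_bound _ (norm_nonneg F) fun ρ => ?_
  refine (norm_ofFunctional_le _).trans ?_
  exact (sliceFunctional R F).le_of_opNorm_le
    (LinearMap.mkContinuous₂_norm_le _ (norm_nonneg F) _) ρ

theorem partialTrace_tmul (F : H →L[ℂ] H) (A : TraceClass R) (B : TraceClass H) :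
    partialTrace R F (A.tmul B) = trace (lmul F B).op • A := by
  refine op_injective (op_ext_inner fun x y => ?_)
  rw [inner_partialTrace, lmul_tmul, trace_tmul, op_smul, smul_apply, inner_smul_right, mul_comm,
    op_lmul _ A]
  have h : rankOne ℂ y x * A.op = rankOne ℂ y (star A.op x) :=
    InnerProductSpace.rankOne_comp y x A.op
  rw [h, trace_rankOne, ContinuousLinearMap.star_eq_adjoint,
    ContinuousLinearMap.adjoint_inner_left]

/-- The partial trace is defined through its pairing with rank-one operators, so pairing it with the
identity is not immediate. The identity is checked on products `A ⊗ B` and extended by density. -/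
theorem trace_partialTrace (F : H →L[ℂ] H) (ρ : TraceClass (HilbertTensor R H)) :
    trace (partialTrace R F ρ).op = trace (lmul (tensorOp 1 F) ρ).op := by
  have h : (traceL R).comp (partialTrace R F) =
      (traceL (HilbertTensor R H)).comp (lmulL _ (tensorOp 1 F)) := by
    refine clm_tensor_ext fun A B => ?_
    simp only [ContinuousLinearMap.comp_apply, traceL_apply, lmulL_apply]
    rw [partialTrace_tmul, lmul_tmul, trace_tmul, op_lmul 1 A, one_mul, mul_comm, op_smul,
      ← traceL_apply, ← smul_eq_mul, ← traceL_apply, ← map_smul]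
    rfl
  exact congrArg (fun k => k ρ) h

/-- The diagonal value at `x` is the trace of `ρ` against the positive operator `|x⟩⟨x| ⊗ F`. -/
theorem isPositive_partialTrace {F : H →L[ℂ] H} (hF : F.IsPositive)
    {ρ : TraceClass (HilbertTensor R H)} (hρ : ρ.op.IsPositive) :
    (partialTrace R F ρ).op.IsPositive := by
  refine isPositive_of_inner_nonneg fun x => ?_
  rw [inner_partialTrace]
  exact trace_lmul_nonneg (isPositive_tensorOp (isPositive_rankOne_self x) hF) hρ

end TraceClass

end Tensor

end SEB

namespace SEB

open InnerProductSpace (rankOne rankOne_apply)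
open TraceClass

/-! ### Countable bases and separability of `T(H)` -/

section Separability

variable {H : Type u} [NormedAddCommGroup H] [InnerProductSpace ℂ H]

/-- Distinct orthonormal vectors are at distance at least one, so balls of radius `1 / 2` around
them are disjoint, and a separable space has only countably many disjoint nonempty open sets. -/
theorem countable_of_orthonormal [TopologicalSpace.SeparableSpace H] {ι : Type*} {b : ι → H}
    (hb : Orthonormal ℂ b) : Countable ι := by
  rw [← Set.countable_univ_iff]
  refine Set.PairwiseDisjoint.countable_of_isOpen (s := fun i => Metric.ball (b i) (1 / 2))
    (fun i _ j _ hij => ?_) (fun _ _ => Metric.isOpen_ball)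
    fun i _ => ⟨b i, Metric.mem_ball_self (by norm_num)⟩
  refine Metric.ball_disjoint_ball ?_
  have h1 : ⟪b i - b j, b i⟫_ℂ = 1 := by
    rw [inner_sub_left, hb.2 hij.symm, inner_self_eq_norm_sq_to_K, hb.1 i]
    simp
  have h2 := norm_inner_le_norm (𝕜 := ℂ) (b i - b j) (b i)
  rw [h1, hb.1 i, mul_one, norm_one] at h2
  rw [dist_eq_norm]
  linarith

variable [CompleteSpace H] [TopologicalSpace.SeparableSpace H]

theorem exists_hilbertBasis_nat (hinf : ¬ FiniteDimensional ℂ H) :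
    Nonempty (HilbertBasis ℕ ℂ H) := by
  let b := basis H
  have hc : Countable (basisIndex H) := countable_of_orthonormal b.orthonormal
  have hi : Infinite (basisIndex H) := by
    by_contra hfin
    rw [not_infinite_iff_finite] at hfin
    have := Fintype.ofFinite (basisIndex H)
    exact hinf b.toOrthonormalBasis.toBasis.finiteDimensional_of_finite
  obtain ⟨hd⟩ := nonempty_denumerable (basisIndex H)
  let e := (Denumerable.eqv (basisIndex H)).symm
  refine ⟨HilbertBasis.mk (b.orthonormal.comp e e.injective) ?_⟩
  rw [e.surjective.range_comp, b.dense_span]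

/-- The column expansion puts every operator in the closed span of countably many continuous images
of `H`. -/
instance : TopologicalSpace.SeparableSpace (TraceClass H) := by
  have hc : Countable (basisIndex H) := countable_of_orthonormal (basis H).orthonormal
  have h1 : TopologicalSpace.IsSeparable
      (⋃ i, Set.range fun x : H => ketBra x (basis H i)) :=
    TopologicalSpace.IsSeparable.iUnion fun i =>
      TopologicalSpace.isSeparable_range ((ketBraL H).flip (basis H i)).continuous
  have h2 := (h1.span (R := ℂ)).closure
  rw [← TopologicalSpace.isSeparable_univ_iff]
  refine h2.mono fun X _ => ?_
  refine mem_closure_of_tendsto (hasSum_ketBra (basis H) X) (Filter.Eventually.of_forall fun s => ?_)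
  exact Submodule.sum_mem _ fun i _ =>
    Submodule.subset_span (Set.mem_iUnion.2 ⟨i, Set.mem_range_self _⟩)

end Separability

/-! ### A closed self-adjoint subspace as the common kernel of effects -/

section Annihilator

variable {H : Type u} [NormedAddCommGroup H] [InnerProductSpace ℂ H] [CompleteSpace H]

theorem trace_lmul_add (A B : H →L[ℂ] H) (X : TraceClass H) :
    trace (lmul (A + B) X).op = trace (lmul A X).op + trace (lmul B X).op := by
  rw [← traceL_apply, ← lmulL_apply, map_add, add_apply, map_add]
  rfl

theorem trace_lmul_smul (c : ℂ) (A : H →L[ℂ] H) (X : TraceClass H) :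
    trace (lmul (c • A) X).op = c * trace (lmul A X).op := by
  rw [← traceL_apply, ← lmulL_apply, map_smul, smul_apply, map_smul]
  rfl

theorem trace_lmul_one (X : TraceClass H) : trace (lmul 1 X).op = trace X.op := by
  rw [op_lmul, one_mul]

theorem trace_lmul_star (A : H →L[ℂ] H) (X : TraceClass H) :
    trace (lmul (star A) X).op = starRingEnd ℂ (trace (lmul A (star X)).op) := by
  rw [← trace_star, op_lmul, trace_mul_comm, op_star, op_lmul, op_star, star_mul, star_star]

/-- The bounded operators that annihilate a closed self-adjoint subspace of `T(H)` in the trace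
pairing contain enough self-adjoint contractions to separate its points from the others. -/
theorem exists_isSelfAdjoint_trace_ne_zero {N : Submodule ℂ (TraceClass H)}
    (hN : IsClosed (N : Set (TraceClass H))) (hstar : ∀ X ∈ N, star X ∈ N) {X : TraceClass H}
    (hX : X ∉ N) : ∃ B : H →L[ℂ] H, IsSelfAdjoint B ∧ ‖B‖ ≤ 1 ∧
      (∀ Y ∈ N, trace (lmul B Y).op = 0) ∧ trace (lmul B X).op ≠ 0 := by
  have : IsClosed (N : Set (TraceClass H)) := hN
  -- Hahn–Banach in the quotient by `N`, which is a normed space because `N` is closed.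
  obtain ⟨f, hf⟩ := SeparatingDual.exists_ne_zero (R := ℂ) (x := N.mkQ X)
    (by rwa [ne_eq, Submodule.mkQ_apply, Submodule.Quotient.mk_eq_zero])
  obtain ⟨B, hB⟩ := exists_trace_lmul_eq (f.comp N.mkQL)
  have hBN : ∀ Y ∈ N, trace (lmul B Y).op = 0 := by
    intro Y hY
    rw [← hB]
    change f (N.mkQ Y) = 0
    rw [Submodule.mkQ_apply, (Submodule.Quotient.mk_eq_zero N).2 hY, map_zero]
  have hBX : trace (lmul B X).op ≠ 0 := by rw [← hB]; exact hf
  have hBN' : ∀ Y ∈ N, trace (lmul (star B) Y).op = 0 := by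
    intro Y hY
    rw [trace_lmul_star, hBN _ (hstar Y hY), map_zero]
  suffices key : ∃ A : H →L[ℂ] H, IsSelfAdjoint A ∧ (∀ Y ∈ N, trace (lmul A Y).op = 0) ∧
      trace (lmul A X).op ≠ 0 by
    obtain ⟨A, hA, hAN, hAX⟩ := key
    have hA0 : ‖A‖ ≠ 0 := by
      intro h
      rw [norm_eq_zero] at h
      refine hAX ?_
      have := trace_lmul_smul 0 A X
      rwa [zero_smul, zero_mul, ← h] at this
    refine ⟨((‖A‖⁻¹ : ℝ) : ℂ) • A, ?_, ?_, fun Y hY => ?_, ?_⟩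
    · rw [IsSelfAdjoint, star_smul, hA.star_eq]
      simp
    · rw [norm_smul]
      simp [hA0]
    · rw [trace_lmul_smul, hAN Y hY, mul_zero]
    · rw [trace_lmul_smul]
      exact mul_ne_zero (by simpa using hA0) hAX
  -- `B` is a combination of the self-adjoint operators `B + B*` and `i (B - B*)`, so one of them
  -- does not annihilate `X`.
  by_cases h1 : trace (lmul (B + star B) X).op = 0
  · refine ⟨Complex.I • (B + (-1 : ℂ) • star B), ?_, fun Y hY => ?_, fun h2 => hBX ?_⟩
    · rw [IsSelfAdjoint]
      simp only [star_smul, star_add, star_star, Complex.star_def, Complex.conj_I,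
        smul_add, smul_smul]
      rw [add_comm]
      simp
    · rw [trace_lmul_smul, trace_lmul_add, trace_lmul_smul, hBN Y hY, hBN' Y hY]
      simp
    · rw [trace_lmul_add] at h1
      rw [trace_lmul_smul, trace_lmul_add, trace_lmul_smul] at h2
      have h3 := (mul_eq_zero.1 h2).resolve_left Complex.I_ne_zero
      linear_combination (h1 + h3) / 2
  · refine ⟨B + star B, ?_, fun Y hY => ?_, h1⟩
    · rw [IsSelfAdjoint, star_add, star_star, add_comm]
    · rw [trace_lmul_add, hBN Y hY, hBN' Y hY, add_zero]

/-- A closed self-adjoint subspace of `T(H)` is the common kernel of countably many self-adjoint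
contractions. -/
theorem exists_seq_trace_eq_zero_iff [TopologicalSpace.SeparableSpace H]
    {N : Submodule ℂ (TraceClass H)}
    (hN : IsClosed (N : Set (TraceClass H))) (hstar : ∀ X ∈ N, star X ∈ N) :
    ∃ B : ℕ → H →L[ℂ] H, (∀ j, IsSelfAdjoint (B j)) ∧ (∀ j, ‖B j‖ ≤ 1) ∧
      ∀ X, X ∈ N ↔ ∀ j, trace (lmul (B j) X).op = 0 := by
  let S : Set (H →L[ℂ] H) :=
    {B | IsSelfAdjoint B ∧ ‖B‖ ≤ 1 ∧ ∀ Y ∈ N, trace (lmul B Y).op = 0}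
  -- The sets where the functionals do not vanish are open and cover the complement of `N`; by the
  -- Lindelöf property, countably many have the same union.
  obtain ⟨T, hT, hTU⟩ := TopologicalSpace.isOpen_iUnion_countable
    (fun B : S => {X : TraceClass H | trace (lmul B.1 X).op ≠ 0}) fun B =>
      isOpen_ne_fun ((traceL H).comp (lmulL H B.1)).continuous continuous_const
  -- Adding the zero operator makes the family nonempty, hence a range over `ℕ`, without changing
  -- the common kernel.
  have h0 : (0 : H →L[ℂ] H) ∈ S := by
    refine ⟨IsSelfAdjoint.zero _, by simp, fun Y _ => ?_⟩
    have := trace_lmul_smul 0 0 Y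
    rwa [zero_smul, zero_mul] at this
  obtain ⟨B, hB⟩ := (hT.insert (⟨0, h0⟩ : S)).exists_eq_range (Set.insert_nonempty _ _)
  refine ⟨fun j => (B j).1, fun j => (B j).2.1, fun j => (B j).2.2.1,
    fun X => ⟨fun hX j => (B j).2.2.2 X hX, fun h => ?_⟩⟩
  by_contra hX
  obtain ⟨A, h1, h2, h3, h4⟩ := exists_isSelfAdjoint_trace_ne_zero hN hstar hX
  have h5 : X ∈ ⋃ B : S, {X : TraceClass H | trace (lmul B.1 X).op ≠ 0} :=
    Set.mem_iUnion.2 ⟨⟨A, h1, h2, h3⟩, h4⟩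
  rw [← hTU] at h5
  obtain ⟨C, hC, hCX⟩ := Set.mem_iUnion₂.1 h5
  have h6 : C ∈ Set.range B := hB ▸ Set.mem_insert_of_mem _ hC
  obtain ⟨j, rfl⟩ := h6
  exact hCX (h j)

theorem isPositive_one_sub {A : H →L[ℂ] H} (hA : IsSelfAdjoint A) (h : ‖A‖ ≤ 1) :
    (1 - A).IsPositive := by
  rw [← ContinuousLinearMap.nonneg_iff_isPositive, sub_nonneg]
  refine hA.le_algebraMap_norm_self.trans ?_
  rw [← map_one (algebraMap ℝ (H →L[ℂ] H))]
  exact algebraMap_mono _ h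

/-- A closed self-adjoint subspace of `T(H)` consisting of operators of trace zero is the common
kernel of a norm-summable resolution of the identity by positive operators. -/
theorem exists_effects [TopologicalSpace.SeparableSpace H] {N : Submodule ℂ (TraceClass H)}
    (hN : IsClosed (N : Set (TraceClass H))) (hstar : ∀ X ∈ N, star X ∈ N)
    (htr : ∀ X ∈ N, trace X.op = 0) :
    ∃ F : ℕ → H →L[ℂ] H, (∀ k, (F k).IsPositive) ∧ (Summable fun k => ‖F k‖) ∧ HasSum F 1 ∧
      ∀ X, X ∈ N ↔ ∀ k, trace (lmul (F k) X).op = 0 := by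
  obtain ⟨B, hBsa, hB1, hBN⟩ := exists_seq_trace_eq_zero_iff hN hstar
  -- Since `‖1 + B j‖ ≤ 2`, the extra factor `1 / 2` gives `‖G j‖ ≤ 2⁻⁽ʲ⁺¹⁾`; these bounds sum to
  -- one, so `‖S‖ ≤ 1`.
  let c : ℕ → ℝ := fun j => 1 / 2 / 2 ^ j / 2
  have hc : ∀ j, 0 < c j := fun j => by positivity
  let G : ℕ → H →L[ℂ] H := fun j => (c j : ℂ) • (1 + B j)
  have hGn : ∀ j, ‖G j‖ ≤ 1 / 2 / 2 ^ j := by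
    intro j
    have h1 : ‖(1 : H →L[ℂ] H) + B j‖ ≤ 2 := by
      refine (norm_add_le _ _).trans ?_
      have : ‖(1 : H →L[ℂ] H)‖ ≤ 1 := ContinuousLinearMap.norm_id_le
      linarith [hB1 j]
    rw [norm_smul, Complex.norm_real, Real.norm_of_nonneg (hc j).le]
    calc c j * ‖1 + B j‖ ≤ c j * 2 := by gcongr
      _ = 1 / 2 / 2 ^ j := by simp only [c]; ring
  have hgeom := hasSum_geometric_two' 1
  have hGs : Summable fun j => ‖G j‖ :=
    Summable.of_nonneg_of_le (fun _ => norm_nonneg _) hGn hgeom.summable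
  have hGsa : ∀ j, IsSelfAdjoint (G j) := by
    intro j
    rw [IsSelfAdjoint, star_smul, star_add, star_one, (hBsa j).star_eq, Complex.star_def,
      Complex.conj_ofReal]
  have hGpos : ∀ j, (G j).IsPositive := by
    intro j
    have h1 := isPositive_one_sub (hBsa j).neg (by rw [norm_neg]; exact hB1 j)
    rw [sub_neg_eq_add] at h1
    exact h1.smul_of_nonneg (by exact_mod_cast (hc j).le)
  set S := ∑' j, G j
  have hS : HasSum G S := hGs.of_norm.hasSum
  have hSsa : IsSelfAdjoint S := by
    rw [IsSelfAdjoint, tsum_star]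
    exact tsum_congr fun j => (hGsa j).star_eq
  have hS1 : ‖S‖ ≤ 1 := tsum_of_norm_bounded hgeom hGn
  -- Index `0` carries the remainder `1 - S`, which makes the total exactly the identity.
  let F : ℕ → H →L[ℂ] H := fun k => Nat.casesOn k (1 - S) G
  have hF : HasSum F 1 := by
    have h1 : HasSum F (F 0 + S) := HasSum.zero_add hS
    have h2 : F 0 + S = 1 := sub_add_cancel _ _
    rwa [h2] at h1
  have hFG : ∀ j, F (j + 1) = G j := fun _ => rfl
  have hG : ∀ j X, trace (lmul (G j) X).op = c j * (trace X.op + trace (lmul (B j) X).op) := by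
    intro j X
    rw [trace_lmul_smul, trace_lmul_add, trace_lmul_one]
  have hsum : ∀ X, HasSum (fun k => trace (lmul (F k) X).op) (trace X.op) := by
    intro X
    have h1 := hF.mapL ((traceL H).comp ((lmulL H).flip X))
    have h2 : (traceL H).comp ((lmulL H).flip X) 1 = trace X.op := trace_lmul_one X
    rw [h2] at h1
    exact h1
  refine ⟨F, fun k => ?_, ?_, hF, fun X => ⟨fun hX => ?_, fun h => ?_⟩⟩
  · cases k with
    | zero => exact isPositive_one_sub hSsa hS1
    | succ j => exact hGpos j
  · exact (summable_nat_add_iff 1).1 hGs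
  · have h1 : ∀ j, trace (lmul (F (j + 1)) X).op = 0 := by
      intro j
      rw [hFG, hG, htr X hX, (hBN X).1 hX j, add_zero, mul_zero]
    intro k
    cases k with
    -- The remainder annihilates `X` as well: all other terms of a series with sum `Tr X = 0`
    -- vanish.
    | zero =>
      have h2 := hsum X
      rw [htr X hX] at h2
      refine (hasSum_single 0 fun k hk => ?_).unique h2
      obtain ⟨j, rfl⟩ := Nat.exists_eq_succ_of_ne_zero hk
      exact h1 j
    | succ j => exact h1 j
  -- Summing all the vanishing terms gives `Tr X = 0`, after which `Tr (G j X) = 0` leaves only `Tr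
  -- (B j X) = 0`.
  · have h1 : trace X.op = 0 := by
      have h2 := hsum X
      simp only [h] at h2
      exact h2.unique hasSum_zero
    refine (hBN X).2 fun j => ?_
    have h2 := hG j X
    rw [← hFG j, h (j + 1), h1, zero_add] at h2
    exact (mul_eq_zero.1 h2.symm).resolve_left (by exact_mod_cast (hc j).ne')

end Annihilator

/-! ### Measure-and-prepare maps as channels -/

section Holevo

variable {H : Type u} [NormedAddCommGroup H] [InnerProductSpace ℂ H] [CompleteSpace H]
variable {K : Type v} [NormedAddCommGroup K] [InnerProductSpace ℂ K] [CompleteSpace K]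

theorem TraceClass.IsState.norm_eq_one {X : TraceClass H} (hX : X.IsState) : ‖X‖ = 1 := by
  have h := norm_eq_trace_of_isPositive hX.1
  rw [hX.2] at h
  exact_mod_cast h

theorem isState_ketBra {x : H} (hx : ‖x‖ = 1) : (ketBra x x).IsState := by
  refine ⟨isPositive_rankOne_self x, ?_⟩
  rw [op_ketBra, trace_rankOne, inner_self_eq_norm_sq_to_K, hx]
  simp

/-- The measure-and-prepare map `X ↦ ∑ₖ Tr (Fₖ X) Rₖ`. -/
noncomputable def holevoMap (R : ℕ → TraceClass K) (F : ℕ → H →L[ℂ] H) : TraceClass H →L[ℂ] TraceClass K :=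
  ∑' k, ((traceL H).comp (lmulL H (F k))).smulRight (R k)

/-- Each term has operator norm at most `‖F k‖`, as states have norm one. The defining series thus
converges in operator norm and may be evaluated at `X`. -/
theorem hasSum_holevoMap {R : ℕ → TraceClass K} {F : ℕ → H →L[ℂ] H}
    (hR : ∀ k, (R k).IsState) (hF : Summable fun k => ‖F k‖) (X : TraceClass H) :
    HasSum (fun k => trace (lmul (F k) X).op • R k) (holevoMap R F X) := by
  have h1 : Summable fun k => ((traceL H).comp (lmulL H (F k))).smulRight (R k) := by
    refine Summable.of_norm_bounded hF fun k => ?_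
    refine ContinuousLinearMap.opNorm_le_bound _ (norm_nonneg _) fun Y => ?_
    change ‖trace (lmul (F k) Y).op • R k‖ ≤ _
    rw [norm_smul, (hR k).norm_eq_one, mul_one]
    exact (norm_trace_le _).trans (norm_lmul_le _ _)
  exact h1.hasSum.mapL (ContinuousLinearMap.apply ℂ (TraceClass K) X)

theorem trace_holevoMap {R : ℕ → TraceClass K} {F : ℕ → H →L[ℂ] H}
    (hR : ∀ k, (R k).IsState) (hF : Summable fun k => ‖F k‖) (hF1 : HasSum F 1)
    (X : TraceClass H) : trace (holevoMap R F X).op = trace X.op := by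
  have h1 := (hasSum_holevoMap hR hF X).mapL (traceL K)
  have h2 := hF1.mapL ((traceL H).comp ((lmulL H).flip X))
  have h3 : (traceL H).comp ((lmulL H).flip X) 1 = trace X.op := trace_lmul_one X
  rw [h3] at h2
  refine h1.unique ?_
  convert h2 using 2 with k
  rw [map_smul, traceL_apply, (hR k).2, smul_eq_mul, mul_one]
  rfl

/-- With `F = T* T`, the `m`-th term of the trace expansion is block positivity of `X` tested on the
vectors `a i • T* bₘ`. -/
theorem sum_conj_mul_trace_nonneg {n : ℕ} {X : Fin n → Fin n → TraceClass H}
    (hX : IsPositiveMatrix X) {F : H →L[ℂ] H} (hF : F.IsPositive) (a : Fin n → ℂ) :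
    0 ≤ ∑ i, ∑ j, starRingEnd ℂ (a i) * a j * trace (lmul F (X i j)).op := by
  obtain ⟨T, rfl⟩ := exists_star_mul_self_eq hF
  have h := hasSum_sum (s := Finset.univ) fun i _ => hasSum_sum (s := Finset.univ) fun j _ =>
    (trace_star_mul_self_mul T (X i j)).mul_left (starRingEnd ℂ (a i) * a j)
  refine h.nonneg fun m => ?_
  have h1 := hX fun i => a i • star T (basis H m)
  simp only [inner_smul_left, map_smul, inner_smul_right] at h1
  refine h1.trans_eq (Finset.sum_congr rfl fun i _ => Finset.sum_congr rfl fun j _ => ?_)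
  ring

/-- Preparing `|eₖ⟩⟨eₖ|` turns the `k`-th term of the quadratic form into a scalar form in the
numbers `a i = ⟪eₖ, x i⟫`, weighted by `Tr (Fₖ X i j)`. -/
theorem isCompletelyPositive_holevoMap {e : ℕ → K} (he : ∀ k, ‖e k‖ = 1) {F : ℕ → H →L[ℂ] H}
    (hF : Summable fun k => ‖F k‖) (hFp : ∀ k, (F k).IsPositive) :
    IsCompletelyPositive (holevoMap (fun k => ketBra (e k) (e k)) F).toLinearMap := by
  intro n X hX x
  have h := hasSum_sum (s := Finset.univ) fun i _ => hasSum_sum (s := Finset.univ) fun j _ =>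
    (hasSum_holevoMap (fun k => isState_ketBra (he k)) hF (X i j)).mapL
      ((innerSL ℂ (x i)).comp ((ContinuousLinearMap.apply ℂ K (x j)).comp (opL K)))
  refine h.nonneg fun k => ?_
  convert sum_conj_mul_trace_nonneg hX (hFp k) (fun i => ⟪e k, x i⟫_ℂ) using 4 with i _ j _
  simp [rankOne_apply]
  ring

/-! ### Ampliation and countable separability -/

section SEB

variable (L : Type w) [NormedAddCommGroup L] [InnerProductSpace ℂ L] [CompleteSpace L]

/-- The ampliation of a measure-and-prepare map, `ρ ↦ ∑ₖ Tr_H ((I ⊗ Fₖ) ρ) ⊗ Rₖ`. -/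
noncomputable def holevoAmpliation (R : ℕ → TraceClass K) (F : ℕ → H →L[ℂ] H) :
    TraceClass (HilbertTensor L H) →L[ℂ] TraceClass (HilbertTensor L K) :=
  ∑' k, ((tmulL L K).flip (R k)).comp (partialTrace L (F k))

variable {L}

theorem hasSum_holevoAmpliation {R : ℕ → TraceClass K} {F : ℕ → H →L[ℂ] H}
    (hR : ∀ k, (R k).IsState) (hF : Summable fun k => ‖F k‖)
    (ρ : TraceClass (HilbertTensor L H)) :
    HasSum (fun k => (partialTrace L (F k) ρ).tmul (R k)) (holevoAmpliation L R F ρ) := by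
  have h1 : Summable fun k => ((tmulL L K).flip (R k)).comp (partialTrace L (F k)) := by
    refine Summable.of_norm_bounded hF fun k => ?_
    refine ContinuousLinearMap.opNorm_le_bound _ (norm_nonneg _) fun Y => ?_
    change ‖(partialTrace L (F k) Y).tmul (R k)‖ ≤ _
    refine (norm_tmul_le _ _).trans ?_
    rw [(hR k).norm_eq_one, mul_one]
    exact (partialTrace L (F k)).le_of_opNorm_le (norm_partialTrace_le (F k)) Y
  exact h1.hasSum.mapL (ContinuousLinearMap.apply ℂ (TraceClass (HilbertTensor L K)) ρ)

theorem isAmpliation_holevoAmpliation {R : ℕ → TraceClass K} {F : ℕ → H →L[ℂ] H}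
    (hR : ∀ k, (R k).IsState) (hF : Summable fun k => ‖F k‖) :
    IsAmpliation (holevoMap R F).toLinearMap (holevoAmpliation L R F) := by
  intro A B
  refine (hasSum_holevoAmpliation hR hF (A.tmul B)).unique ?_
  have h := (hasSum_holevoMap hR hF B).mapL (tmulL L K A)
  have h1 : ∀ k, tmulL L K A (trace (lmul (F k) B).op • R k) =
      (partialTrace L (F k) (A.tmul B)).tmul (R k) := by
    intro k
    rw [partialTrace_tmul, map_smul, ← tmulL_apply, map_smul, smul_apply]
  simp only [h1] at h
  exact h

theorem hasSum_trace_partialTrace {F : ℕ → H →L[ℂ] H} (hF1 : HasSum F 1)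
    (ρ : TraceClass (HilbertTensor L H)) :
    HasSum (fun k => trace (partialTrace L (F k) ρ).op) (trace ρ.op) := by
  -- The functional `A ↦ Tr ((I ⊗ A) ρ)` is bounded, so it can be applied to the norm-convergent
  -- series `∑ Fₖ = I`.
  let f : (H →L[ℂ] H) →L[ℂ] ℂ := LinearMap.mkContinuous
    { toFun := fun A => traceL _ (lmulL _ (tensorOp (1 : L →L[ℂ] L) A) ρ)
      map_add' := fun _ _ => by simp only [tensorOp_add_right, map_add, add_apply]
      map_smul' := fun _ _ => by
        simp only [tensorOp_smul_right, map_smul, smul_apply, RingHom.id_apply] }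
    (‖(1 : L →L[ℂ] L)‖ * ‖ρ‖) fun A => by
      change ‖trace (lmul (tensorOp 1 A) ρ).op‖ ≤ _
      refine (norm_trace_le _).trans ((norm_lmul_le _ _).trans ?_)
      calc ‖tensorOp 1 A‖ * ‖ρ‖ ≤ ‖(1 : L →L[ℂ] L)‖ * ‖A‖ * ‖ρ‖ := by
            gcongr; exact norm_tensorOp_le 1 A
        _ = ‖(1 : L →L[ℂ] L)‖ * ‖ρ‖ * ‖A‖ := by ring
  have hf : ∀ A, f A = trace (lmul (tensorOp 1 A) ρ).op := fun _ => rfl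
  have h := hF1.mapL f
  simp only [hf, tensorOp_one_one, trace_lmul_one] at h
  simp only [trace_partialTrace]
  exact h

/-- The terms of a convex series can be split, so that infinitely many weights remain and all of
them are positive. -/
theorem exists_pos_weights {E : Type*} [NormedAddCommGroup E] [NormedSpace ℂ E] [CompleteSpace E]
    {q : ℕ → ℝ} {t : ℕ → E} {σ : E} (hq0 : ∀ k, 0 ≤ q k) (hq : HasSum q 1) (ht : ∀ k, ‖t k‖ ≤ 1)
    (hσ : HasSum (fun k => (q k : ℂ) • t k) σ) :
    ∃ (p : ℕ → ℝ) (n : ℕ → ℕ), (∀ i, 0 < p i) ∧ (∀ i, q (n i) ≠ 0) ∧ HasSum p 1 ∧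
      HasSum (fun i => (p i : ℂ) • t (n i)) σ := by
  -- Zero weights are discarded here. What remains may be finite, so each surviving weight is later
  -- split by a geometric series, giving infinitely many strictly positive weights.
  let s : Set ℕ := {k | q k ≠ 0}
  have hqs : HasSum (fun k : s => q k) 1 :=
    (hasSum_subtype_iff_of_support_subset (f := q) fun k hk => hk).2 hq
  have hσs : HasSum (fun k : s => (q k : ℂ) • t k) σ := by
    have hsupp : Function.support (fun k => (q k : ℂ) • t k) ⊆ s := fun k hk hk0 =>
      hk (by simp only [hk0, Complex.ofReal_zero, zero_smul])
    exact (hasSum_subtype_iff_of_support_subset hsupp).2 hσ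
  have hne : Nonempty s := by
    by_contra h
    rw [not_nonempty_iff] at h
    exact one_ne_zero (hqs.unique hasSum_empty)
  obtain ⟨c, hc0, hc⟩ : ∃ c : ℕ → ℝ, (∀ m, 0 < c m) ∧ HasSum c 1 :=
    ⟨fun m => 1 / 2 / 2 ^ m, fun m => by positivity, hasSum_geometric_two' 1⟩
  have hqp : ∀ k : s, 0 < q k := fun k => lt_of_le_of_ne (hq0 k) (Ne.symm k.2)
  have hp : HasSum (fun i : s × ℕ => q i.1 * c i.2) 1 := by
    have h1 := hqs.mul hc (hqs.summable.mul_of_nonneg hc.summable (fun k => (hqp k).le)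
      fun m => (hc0 m).le)
    rwa [one_mul] at h1
  have h1 : Summable fun i : s × ℕ => ((q i.1 * c i.2 : ℝ) : ℂ) • t i.1 := by
    refine Summable.of_norm_bounded hp.summable fun i => ?_
    rw [norm_smul, Complex.norm_real, Real.norm_of_nonneg (mul_pos (hqp _) (hc0 _)).le]
    exact mul_le_of_le_one_right (mul_pos (hqp _) (hc0 _)).le (ht _)
  have h2 := h1.hasSum.prod_fiberwise (g := fun k : s => (q k : ℂ) • t k) fun k => by
    have h3 := (Complex.hasSum_ofReal.2 (hc.mul_left (q k))).smul_const (t k)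
    rwa [mul_one] at h3
  -- `s` is nonempty because its weights sum to one, so `s × ℕ` is countably infinite.
  obtain ⟨e⟩ : Nonempty (ℕ ≃ s × ℕ) := (nonempty_equiv_of_countable)
  refine ⟨fun i => q (e i).1 * c (e i).2, fun i => (e i).1, fun i => mul_pos (hqp _) (hc0 _),
    fun i => (e i).1.2, e.hasSum_iff.2 hp, ?_⟩
  rw [hσs.unique h2]
  exact e.hasSum_iff.2 h1.hasSum

/-- A normalized series `∑ Aₖ ⊗ Rₖ` of positive product operators is countably separable. -/
theorem isCountablySeparable_of_hasSum {σ : TraceClass (HilbertTensor L K)} {A : ℕ → TraceClass L}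
    {R : ℕ → TraceClass K} (hA : ∀ k, (A k).op.IsPositive)
    (hA1 : HasSum (fun k => trace (A k).op) 1) (hR : ∀ k, (R k).IsState)
    (hσ : HasSum (fun k => (A k).tmul (R k)) σ) : IsCountablySeparable σ := by
  have hq : HasSum (fun k => ‖A k‖) 1 := by
    have h1 : HasSum (fun k => ((‖A k‖ : ℝ) : ℂ)) ((1 : ℝ) : ℂ) := by
      simpa only [norm_eq_trace_of_isPositive (hA _), Complex.ofReal_one] using hA1
    exact Complex.hasSum_ofReal.1 h1
  -- If `A k = 0`, then `g k = 0` is not a state. Such indices carry weight zero and are removed by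
  -- `exists_pos_weights`.
  obtain ⟨g, hgA⟩ : ∃ g : ℕ → TraceClass L, ∀ k, g k = ((‖A k‖⁻¹ : ℝ) : ℂ) • A k :=
    ⟨_, fun _ => rfl⟩
  have hAg : ∀ k, ((‖A k‖ : ℝ) : ℂ) • g k = A k := by
    intro k
    rcases eq_or_ne (A k) 0 with h | h
    · rw [hgA, h, smul_zero, smul_zero]
    · rw [hgA, smul_smul, ← Complex.ofReal_mul, mul_inv_cancel₀ (norm_ne_zero_iff.2 h),
        Complex.ofReal_one, one_smul]
  have hg : ∀ k, ‖A k‖ ≠ 0 → (g k).IsState := by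
    intro k hk
    rw [hgA]
    refine ⟨(hA k).smul_of_nonneg (by exact_mod_cast inv_nonneg.2 (norm_nonneg (A k))), ?_⟩
    rw [← traceL_apply, map_smul, traceL_apply, ← norm_eq_trace_of_isPositive (hA k), smul_eq_mul,
      ← Complex.ofReal_mul, inv_mul_cancel₀ hk, Complex.ofReal_one]
  have hg1 : ∀ k, ‖(g k).tmul (R k)‖ ≤ 1 := by
    intro k
    refine (norm_tmul_le _ _).trans ?_
    rw [(hR k).norm_eq_one, mul_one, hgA, norm_smul, Complex.norm_real, norm_inv, norm_norm]
    exact inv_mul_le_one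
  have hterm : ∀ k, (A k).tmul (R k) = ((‖A k‖ : ℝ) : ℂ) • (g k).tmul (R k) := by
    intro k
    conv_lhs => rw [← hAg k]
    rw [← tmulL_apply, map_smul, smul_apply, tmulL_apply]
  simp only [hterm] at hσ
  obtain ⟨p, n, hp0, hn, hp, hpσ⟩ := exists_pos_weights (fun k => norm_nonneg (A k)) hq hg1 hσ
  exact ⟨p, g ∘ n, R ∘ n, hp0, hp, fun i => hg _ (hn i), fun i => hR _, hpσ⟩

end SEB

theorem isSEB_holevoMap {R : ℕ → TraceClass K} {F : ℕ → H →L[ℂ] H}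
    (hR : ∀ k, (R k).IsState) (hF : Summable fun k => ‖F k‖) (hFp : ∀ k, (F k).IsPositive)
    (hF1 : HasSum F 1) : IsSEB.{u, v, w} (holevoMap R F).toLinearMap := by
  intro L _ _ _
  refine ⟨holevoAmpliation L R F, isAmpliation_holevoAmpliation hR hF, fun ρ hρ => ?_⟩
  refine isCountablySeparable_of_hasSum (fun k => isPositive_partialTrace (hFp k) hρ.1) ?_ hR
    (hasSum_holevoAmpliation hR hF ρ)
  rw [← hρ.2]
  exact hasSum_trace_partialTrace hF1 ρ

/-- By orthonormality, the matrix element of the image at `e k` is exactly `Tr (Fₖ X)`. -/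
theorem holevoMap_eq_zero_iff {e : ℕ → K} (he : Orthonormal ℂ e) {F : ℕ → H →L[ℂ] H}
    (hF : Summable fun k => ‖F k‖) (X : TraceClass H) :
    holevoMap (fun k => ketBra (e k) (e k)) F X = 0 ↔ ∀ k, trace (lmul (F k) X).op = 0 := by
  have h := hasSum_holevoMap (fun k => isState_ketBra (he.1 k)) hF X
  refine ⟨fun h0 k => ?_, fun h0 => ?_⟩
  · rw [h0] at h
    have h1 := h.mapL
      ((innerSL ℂ (e k)).comp ((ContinuousLinearMap.apply ℂ K (e k)).comp (opL K)))
    rw [map_zero] at h1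
    have h2 := h1.unique (hasSum_single k fun j hj => ?_)
    · simpa [he.1 k] using h2.symm
    · simp [he.2 hj]
  · simp only [h0, zero_smul] at h
    exact h.unique hasSum_zero

end Holevo

end SEB

theorem theorem3p2 {H : Type u} [NormedAddCommGroup H] [InnerProductSpace ℂ H] [CompleteSpace H]
    [TopologicalSpace.SeparableSpace H] (hinf : ¬ FiniteDimensional ℂ H)
    (N : Submodule ℂ (SEB.TraceClass H))
    (hN_closed : IsClosed (N : Set (SEB.TraceClass H)))
    (hN_star : ∀ X ∈ N, star X ∈ N)
    (hN_trace : ∀ X ∈ N, SEB.trace X.op = 0) :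
    ∃ Φ : SEB.TraceClass H →ₗ[ℂ] SEB.TraceClass H,
      SEB.IsChannel Φ ∧ SEB.IsSEB.{u, u, w} Φ ∧ LinearMap.ker Φ = N ∧
        ∃ (e : HilbertBasis ℕ ℂ H) (R : ℕ → SEB.TraceClass H) (F : ℕ → H →L[ℂ] H),
          (∀ k, (R k).op = InnerProductSpace.rankOne ℂ (e k) (e k)) ∧
            SEB.HasHolevoForm Φ R F := by
  obtain ⟨e⟩ := SEB.exists_hilbertBasis_nat hinf
  obtain ⟨F, hFp, hF, hF1, hFN⟩ := SEB.exists_effects hN_closed hN_star hN_trace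
  have hR := fun k => SEB.isState_ketBra (e.orthonormal.1 k)
  refine ⟨(SEB.holevoMap (fun k => SEB.TraceClass.ketBra (e k) (e k)) F).toLinearMap,
    ⟨SEB.isCompletelyPositive_holevoMap e.orthonormal.1 hF hFp, SEB.trace_holevoMap hR hF hF1⟩,
    SEB.isSEB_holevoMap hR hF hFp hF1, ?_, e, _, F, fun k => rfl, hR, hFp,
    fun x => hF1.mapL (ContinuousLinearMap.apply ℂ H x), SEB.hasSum_holevoMap hR hF⟩
  ext X
  rw [LinearMap.mem_ker, hFN]
  exact SEB.holevoMap_eq_zero_iff e.orthonormal hF X
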